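/- Let $\theta_1,\theta_2\in[0,2\pi)\setminus\{0,\pi/2,\pi,3\pi/2\}$, write $c_j=\cos\theta_j$, $s_j=\sin\theta_j$, and let $$C_j=c_j|0\rangle\langle 0|+s_j|0\rangle\langle 1|+s_j|1\rangle\langle 0|-c_j|1\rangle\langle 1|\qquad(j=1,2).$$ The 2-period quantum walk on $\mathbb Z$ with inner states $0,1$ is defined by $$|\Phi_{t+1}\rangle=\begin{cases}S\,(I\otimes C_1)|\Phi_t\rangle,& t \text{ even},\\ S\,(I\otimes C_2)|\Phi_t\rangle,& t\text{ odd},\end{cases}\qquad S=\sum_{x\in\mathbb Z}\big(|x-1\rangle\langle x|\otimes|0\rangle\langle 0|+|x+1\rangle\langle x|\otimes|1\rangle\langle 1|\big),$$ $$|\Phi_0\rangle=|{-1}\rangle\otimes(\alpha_{-1}|0\rangle+\beta_{-1}|1\rangle)+|0\rangle\otimes(\alpha_0|0\rangle+\beta_0|1\rangle),$$ where $\alpha_{-1},\beta_{-1},\alpha_0,\beta_0\in\mathbb C$ satisfy $|\alpha_{-1}|^2+|\beta_{-1}|^2+|\alpha_0|^2+|\beta_0|^2=1$. Let $\mathbb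 P(Y_t=x;j)=|(\langle x|\otimes\langle j|)|\Phi_t\rangle|^2$ and $\mathbb P(Y_t=x)=\mathbb P(Y_t=x;0)+\mathbb P(Y_t=x;1)$; accordingly, $\mathbb P(Y_t/t\le x;j)=\sum_{y\in\mathbb Z,\,y/t\le x}\mathbb P(Y_t=y;j)$, and similarly for $\mathbb P(Y_t/t\le x)$. Let $\xi\in\{1,2\}$ be such that $|c_\xi|=\min\{|c_1|,|c_2|\}$, and put $$\eta(y)=1-\Big(|\alpha_{-1}|^2+|\alpha_0|^2-|\beta_{-1}|^2-|\beta_0|^2+\frac{2s_1\,\mathrm{Re}(\alpha_{-1}\overline{\beta_{-1}}+\alpha_0\overline{\beta_0})}{c_1}\Big)y .$$ Then, for every $x\in\mathbb R$, $$\lim_{t\to\infty}\mathbb P\Big(\frac{Y_t}{t}\le x;0\Big)=\int_{-\infty}^x\frac{|s_\xi|}{2\pi(1+y)\sqrt{c_\xi^2-y^2}}\,\eta(y)\,I_{(-|c_\xi|,|c_\xi|)}(y)\,dy,$$ $$\lim_{t\to\infty}\mathbb P\Big(\frac{Y_t}{t}\le x;1\Big)=\int_{-\infty}^x\frac{|s_\xi|}{2\pi(1-y)\sqrt{c_\xi^2-y^2}}\,\eta(y)\,I_{(-|c_\xi|,|c_\xi|)}(y)\,dy,$$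 $$\lim_{t\to\infty}\mathbb P\Big(\frac{Y_t}{t}\le x\Big)=\int_{-\infty}^x\frac{|s_\xi|}{\pi(1-y^2)\sqrt{c_\xi^2-y^2}}\,\eta(y)\,I_{(-|c_\xi|,|c_\xi|)}(y)\,dy,$$ where $I_A$ is the indicator function of $A$ and the three integrands are Lebesgue integrable on $\mathbb R$. -/

import Mathlib

open Filter Topology MeasureTheory

noncomputable section

namespace TwoPeriodWalk

/-- Amplitudes of a state of the walk on `ℤ` with inner states `0, 1`: `Φ x j` is the
coefficient of `|x⟩ ⊗ |j⟩`. -/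
abbrev State : Type := ℤ → Fin 2 → ℂ

/-- The product state `|x⟩ ⊗ (v 0 |0⟩ + v 1 |1⟩)`. -/
def ket (x : ℤ) (v : Fin 2 → ℂ) : State := Pi.single x v

/-- The coin `cos θ |0⟩⟨0| + sin θ |0⟩⟨1| + sin θ |1⟩⟨0| - cos θ |1⟩⟨1|`. -/
def coin (θ : ℝ) : Matrix (Fin 2) (Fin 2) ℂ :=
  !![(Real.cos θ : ℂ), (Real.sin θ : ℂ); (Real.sin θ : ℂ), -(Real.cos θ : ℂ)]

/-- The operator `∑ₓ |x⟩⟨x| ⊗ C`. -/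
def coinOp (C : Matrix (Fin 2) (Fin 2) ℂ) (Φ : State) : State := fun x => C.mulVec (Φ x)

/-- The shift `∑ₓ (|x-1⟩⟨x| ⊗ |0⟩⟨0| + |x+1⟩⟨x| ⊗ |1⟩⟨1|)`, on amplitudes. -/
def shift (Φ : State) : State := fun x => ![Φ (x + 1) 0, Φ (x - 1) 1]

/-- The state at time `t`: the step from an even time uses the coin of angle `θ₁`, the step
from an odd time the coin of angle `θ₂`. -/
def walk (θ₁ θ₂ : ℝ) (Φ₀ : State) : ℕ → State
  | 0 => Φ₀
  | t + 1 => shift (coinOp (coin (if Even t then θ₁ else θ₂)) (walk θ₁ θ₂ Φ₀ t))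

/-- The state `|-1⟩ ⊗ (α₋₁|0⟩ + β₋₁|1⟩) + |0⟩ ⊗ (α₀|0⟩ + β₀|1⟩)`. -/
def initialState (αm βm α₀ β₀ : ℂ) : State := ket (-1) ![αm, βm] + ket 0 ![α₀, β₀]

/-- Probability of finding the walker at `x` in inner state `j`. -/
def prob (Φ : State) (x : ℤ) (j : Fin 2) : ℝ := ‖Φ x j‖ ^ 2

/-- Probability of finding the walker at a position `y` with `y / t ≤ x` and in inner
state `j`. -/
def cdfInner (Φ : State) (t : ℕ) (x : ℝ) (j : Fin 2) : ℝ :=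
  ∑' y : {y : ℤ // (y : ℝ) / (t : ℝ) ≤ x}, prob Φ y j

/-- Probability of finding the walker at a position `y` with `y / t ≤ x`, in either inner
state. -/
def cdf (Φ : State) (t : ℕ) (x : ℝ) : ℝ :=
  ∑' y : {y : ℤ // (y : ℝ) / (t : ℝ) ≤ x}, ∑ j : Fin 2, prob Φ y j

/-- Only finitely many sites carry a nonzero amplitude, so the sums above are finite sums. -/
theorem finite_support_walk (θ₁ θ₂ : ℝ) (αm βm α₀ β₀ : ℂ) (t : ℕ) :
    {x : ℤ | walk θ₁ θ₂ (initialState αm βm α₀ β₀) t x ≠ 0}.Finite := by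
  refine (Set.finite_Icc (-1 - t : ℤ) t).subset fun x hx => ?_
  by_contra h
  apply hx
  clear hx
  induction t generalizing x with
  | zero =>
    have h1 : x ≠ -1 := by rintro rfl; simp at h
    have h2 : x ≠ 0 := by rintro rfl; simp at h
    simp [walk, initialState, ket, h1, h2]
  | succ t ih =>
    simp only [Set.mem_Icc, not_and_or, not_le] at h ih
    push_cast at h
    have h1 := ih (x + 1) (by omega)
    have h2 := ih (x - 1) (by omega)
    ext j
    fin_cases j <;> simp [walk, shift, coinOp, h1, h2]

/-- The linear function `η` fixed by the initial amplitudes and the first coin. -/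
def eta (θ₁ : ℝ) (αm βm α₀ β₀ : ℂ) (y : ℝ) : ℝ :=
  1 - (‖αm‖ ^ 2 + ‖α₀‖ ^ 2 - ‖βm‖ ^ 2 - ‖β₀‖ ^ 2
      + 2 * Real.sin θ₁ * (αm * starRingEnd ℂ βm + α₀ * starRingEnd ℂ β₀).re / Real.cos θ₁) * y

/-- Limit density for inner state `0`; `θ` is the angle `θ_ξ` and `η` the linear factor. -/
def density0 (θ : ℝ) (η : ℝ → ℝ) : ℝ → ℝ :=
  Set.indicator (Set.Ioo (-|Real.cos θ|) |Real.cos θ|) fun y =>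
    |Real.sin θ| / (2 * Real.pi * (1 + y) * √(Real.cos θ ^ 2 - y ^ 2)) * η y

/-- Limit density for inner state `1`. -/
def density1 (θ : ℝ) (η : ℝ → ℝ) : ℝ → ℝ :=
  Set.indicator (Set.Ioo (-|Real.cos θ|) |Real.cos θ|) fun y =>
    |Real.sin θ| / (2 * Real.pi * (1 - y) * √(Real.cos θ ^ 2 - y ^ 2)) * η y

/-- Limit density of the position. -/
def density (θ : ℝ) (η : ℝ → ℝ) : ℝ → ℝ :=
  Set.indicator (Set.Ioo (-|Real.cos θ|) |Real.cos θ|) fun y =>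
    |Real.sin θ| / (Real.pi * (1 - y ^ 2) * √(Real.cos θ ^ 2 - y ^ 2)) * η y

end TwoPeriodWalk

end

/-! In momentum space each step is a 2×2 unitary, and a double step at momentum `k` is an SU(2)
matrix `cos ω + i sin ω · N`, where `cos ω = c₁c₂ cos 2k + s₁s₂` and `N` is a Hermitian involution.
Its `n`-th power is therefore `e^{inω}P₊ + e^{-inω}P₋` (`evolve_eq`). By Parseval
(`sum_exp_mul_prob`) the characteristic function of `Y_t/t` in one inner state is the mean over `k`
of the conjugate amplitude at `k` times the amplitude at `k - u/t`. As `t → ∞` the phase difference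
within one branch tends to `∓u v(k)` with `v = ω'/2`. The products of different branches carry
`e^{±2inω}` and vanish by Riemann–Lebesgue. What survives is the mean of `stationary`
(`tendsto_integral_evolve`).

The weight of a branch factors as a diagonal entry of `P_±` times the expectation of `P_±`
(`conj_branch_mul_branch`). Averaging over `k`, `k + π`, `-k`, `-k + π` removes the interference of
the two initial sites and everything not odd in `k`. The off-diagonal entry of `N` has real part
`tan θ₁ · v`, so the initial state enters only through the linear factor `1 - K y`
(`integral_stationary`, `axisQuad_initHat`).

It remains to find the law of `v` at a uniform momentum. If `|c₁| ≤ |c₂|`, then `v` is an explicit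
function of `sin 2k / |e^{2ik} - r|` with `|r| ≤ 1`. This quotient is the sine of the direction of
`e^{2ik} - r`, which has the law of the sine of a uniform angle (`integral_sin_div_sqrt`). So `v` is
distributed as for the constant coin with the smaller `|cos|`, and a change of variables gives
`arcDensity`. The other case follows since `v` is symmetric in the two angles.

At odd times the walk is a double-step walk with the coins exchanged, started after one step. That
step preserves the expectation of the axis (`axisQuad_stepHat`), so the limit is the same. A form of
Lévy's continuity theorem for measures of mass at most one then turns characteristic functions into
distribution functions. -/

namespace TwoPeriodWalk

/-! ### Riemann–Lebesgue with a phase, and continuity theorems for distribution functions -/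

/-- Riemann–Lebesgue for a phase function that is injective with nonvanishing derivative. -/
theorem tendsto_setIntegral_exp_phase {s : Set ℝ} (hs : MeasurableSet s) {f f' : ℝ → ℝ}
    (hf : ∀ x ∈ s, HasDerivWithinAt f (f' x) s x) (hinj : Set.InjOn f s)
    (h0 : ∀ x ∈ s, f' x ≠ 0) (g : ℝ → ℂ) :
    Tendsto (fun w : ℝ => ∫ x in s, Complex.exp (w * f x * Complex.I) * g x)
      (cocompact ℝ) (𝓝 0) := by
  set φ : ℝ → ℝ := Function.invFunOn f s with hφ
  have hleft : ∀ x ∈ s, φ (f x) = x := fun x hx => hinj.leftInvOn_invFunOn hx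
  -- The density `g dx` transported to the variable `v = f x`, so that the phase becomes linear.
  set G : ℝ → ℂ := (f '' s).indicator (fun y => ((|f' (φ y)|)⁻¹ : ℝ) • g (φ y)) with hG
  have him : MeasurableSet (f '' s) :=
    hs.image_of_continuousOn_injOn (fun x hx => (hf x hx).continuousWithinAt) hinj
  have key : ∀ w : ℝ, ∫ x in s, Complex.exp (w * f x * Complex.I) * g x
      = ∫ v : ℝ, Complex.exp (w * v * Complex.I) * G v := by
    intro w
    have h1 : ∫ v : ℝ, Complex.exp (w * v * Complex.I) * G v
        = ∫ v in f '' s, Complex.exp (w * v * Complex.I) *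
            (((|f' (φ v)|)⁻¹ : ℝ) • g (φ v)) := by
      rw [← integral_indicator him]
      congr 1
      ext v
      by_cases hv : v ∈ f '' s <;> simp [hG, hv]
    rw [h1, integral_image_eq_integral_abs_deriv_smul hs hf hinj]
    refine setIntegral_congr_fun hs fun x hx => ?_
    have h2 : |f' x| ≠ 0 := abs_ne_zero.mpr (h0 x hx)
    have h3 : ((|f' x| : ℝ) : ℂ) ≠ 0 := by exact_mod_cast h2
    simp only [hleft x hx, Complex.real_smul, Complex.ofReal_inv]
    field_simp
  simp_rw [key]
  -- This holds for every function, the integral of a non-integrable one being zero; hence `g` is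
  -- arbitrary. The rescaling `h5` undoes the normalisation `e^{-2πivw}` of the Fourier character.
  have h4 := Real.tendsto_integral_exp_smul_cocompact G
  have h5 : Tendsto (fun w : ℝ => -(w / (2 * Real.pi))) (cocompact ℝ) (cocompact ℝ) := by
    have hpi : (2 * Real.pi)⁻¹ ≠ 0 := by positivity
    have := (Homeomorph.mulRight₀ (-(2 * Real.pi)⁻¹)
      (neg_ne_zero.mpr hpi)).isClosedEmbedding.tendsto_cocompact
    refine this.congr fun w => ?_
    simp [div_eq_mul_inv]
  refine (h4.comp h5).congr fun w => ?_
  simp only [Function.comp]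
  congr 1
  ext v
  rw [Circle.smul_def, Real.fourierChar_apply, smul_eq_mul]
  congr 2
  push_cast
  have : (Real.pi : ℂ) ≠ 0 := by exact_mod_cast Real.pi_ne_zero
  field_simp

/-- A measure of mass at most one, completed to a probability measure by an atom at `z`. -/
noncomputable def completeWithAtom (μ : Measure ℝ) (z : ℝ) : Measure ℝ :=
  μ + (1 - μ Set.univ) • Measure.dirac z

theorem isProbabilityMeasure_completeWithAtom {μ : Measure ℝ} (h : μ Set.univ ≤ 1) (z : ℝ) :
    IsProbabilityMeasure (completeWithAtom μ z) :=
  ⟨by simp [completeWithAtom, add_tsub_cancel_of_le h]⟩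

/-- The missing mass is read off from the characteristic function at `0`, so pointwise convergence
passes to the completed measures. -/
theorem charFun_completeWithAtom {μ : Measure ℝ} [IsFiniteMeasure μ] (h : μ Set.univ ≤ 1)
    (z u : ℝ) : charFun (completeWithAtom μ z) u
      = charFun μ u + (1 - charFun μ 0) * Complex.exp (u * z * Complex.I) := by
  have hf : ∀ ρ : Measure ℝ, IsFiniteMeasure ρ →
      Integrable (fun x : ℝ => Complex.exp (u * x * Complex.I)) ρ := by
    intro ρ _
    refine (integrable_const (1 : ℝ)).mono' (by fun_prop) (Eventually.of_forall fun x => ?_)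
    rw [show (u * x * Complex.I : ℂ) = ((u * x : ℝ) : ℂ) * Complex.I by push_cast; ring,
      Complex.norm_exp_ofReal_mul_I]
  have : IsFiniteMeasure ((1 - μ Set.univ) • Measure.dirac z) :=
    ⟨by simpa using (tsub_le_self).trans_lt ENNReal.one_lt_top⟩
  rw [charFun_apply_real, completeWithAtom, integral_add_measure (hf _ inferInstance)
    (hf _ inferInstance), integral_smul_measure, integral_dirac, charFun_apply_real, charFun_zero,
    ENNReal.toReal_sub_of_le h ENNReal.one_ne_top]
  simp [Measure.real, Complex.real_smul]

/-- Convergence of characteristic functions of measures of mass at most one implies convergence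
of distribution functions. -/
theorem tendsto_real_Iic_of_tendsto_charFun {μs : ℕ → Measure ℝ} {μ : Measure ℝ}
    [∀ t, IsFiniteMeasure (μs t)] [IsFiniteMeasure μ] (hmass : ∀ t, μs t Set.univ ≤ 1)
    (h : ∀ u : ℝ, Tendsto (fun t => charFun (μs t) u) atTop (𝓝 (charFun μ u)))
    {x : ℝ} (hx : μ {x} = 0) :
    Tendsto (fun t => (μs t).real (Set.Iic x)) atTop (𝓝 (μ.real (Set.Iic x))) := by
  have hμ : μ Set.univ ≤ 1 := by
    have h0 := h 0
    simp_rw [charFun_zero] at h0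
    have h1 : Tendsto (fun t => (μs t).real Set.univ) atTop (𝓝 (μ.real Set.univ)) := by
      have := (Complex.continuous_re.tendsto _).comp h0
      simpa [Function.comp_def] using this
    have h2 : μ.real Set.univ ≤ 1 := le_of_tendsto' h1 fun t =>
      ENNReal.toReal_le_of_le_ofReal zero_le_one (by simpa using hmass t)
    rw [Measure.real] at h2
    exact (ENNReal.toReal_le_toReal (measure_ne_top _ _) ENNReal.one_ne_top).1 (by simpa using h2)
  -- The atom sits at `x + 1`, to the right of `Set.Iic x` and off its frontier, so it is invisible
  -- to the distribution function at `x`.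
  have hval : ∀ ρ : Measure ℝ, (completeWithAtom ρ (x + 1)) (Set.Iic x) = ρ (Set.Iic x) := by
    intro ρ
    simp [completeWithAtom, Measure.dirac_apply' _ measurableSet_Iic]
  let P : ℕ → ProbabilityMeasure ℝ := fun t =>
    ⟨completeWithAtom (μs t) (x + 1), isProbabilityMeasure_completeWithAtom (hmass t) _⟩
  let P₀ : ProbabilityMeasure ℝ :=
    ⟨completeWithAtom μ (x + 1), isProbabilityMeasure_completeWithAtom hμ _⟩
  have hP : Tendsto P atTop (𝓝 P₀) := by
    refine ProbabilityMeasure.tendsto_of_tendsto_charFun fun u => ?_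
    simp only [P, P₀, ProbabilityMeasure.coe_mk]
    rw [charFun_completeWithAtom hμ]
    simp_rw [charFun_completeWithAtom (hmass _)]
    exact (h u).add ((tendsto_const_nhds.sub (h 0)).mul tendsto_const_nhds)
  have hfr : (P₀ : Measure ℝ) (frontier (Set.Iic x)) = 0 := by
    rw [frontier_Iic]
    simp [P₀, completeWithAtom, hx]
  have h3 := ProbabilityMeasure.tendsto_measure_of_null_frontier_of_tendsto' hP hfr
  simp only [P, P₀, ProbabilityMeasure.coe_mk, hval] at h3
  exact (ENNReal.tendsto_toReal (measure_ne_top _ _)).comp h3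

/-- Convergence of the characteristic functions of finitely supported weights to that of an
integrable density implies convergence of the distribution functions. -/
theorem tendsto_sum_filter_of_tendsto_exp {p : ℕ → ℤ → ℝ} (hp : ∀ t y, 0 ≤ p t y)
    {S : ℕ → Finset ℤ} (hS : ∀ t, ∑ y ∈ S t, p t y ≤ 1) {ρ : ℝ → ℝ} (hρ0 : ∀ y, 0 ≤ ρ y)
    (hρ : Integrable ρ)
    (h : ∀ u : ℝ, Tendsto (fun t : ℕ => ∑ y ∈ S t,
      Complex.exp (u * ((y : ℝ) / (t : ℝ) : ℝ) * Complex.I) * p t y) atTop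
      (𝓝 (∫ y : ℝ, Complex.exp (u * y * Complex.I) * ρ y))) (x : ℝ) :
    Tendsto (fun t : ℕ => ∑ y ∈ (S t).filter (fun y : ℤ => (y : ℝ) / (t : ℝ) ≤ x), p t y) atTop
      (𝓝 (∫ y in Set.Iic x, ρ y)) := by
  let μs : ℕ → Measure ℝ := fun t =>
    ∑ y ∈ S t, ENNReal.ofReal (p t y) • Measure.dirac ((y : ℝ) / (t : ℝ))
  let μ : Measure ℝ := volume.withDensity fun y => ENNReal.ofReal (ρ y)
  have hfin : ∀ t, IsFiniteMeasure (μs t) := by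
    intro t
    refine ⟨?_⟩
    simp only [μs, Measure.finsetSum_apply, Measure.smul_apply, smul_eq_mul, measure_univ, mul_one]
    exact ENNReal.sum_lt_top.2 fun y _ => ENNReal.ofReal_lt_top
  have : IsFiniteMeasure μ := isFiniteMeasure_withDensity_ofReal hρ.2
  have hmass : ∀ t, μs t Set.univ ≤ 1 := by
    intro t
    simp only [μs, Measure.finsetSum_apply, Measure.smul_apply, smul_eq_mul, measure_univ, mul_one]
    rw [← ENNReal.ofReal_sum_of_nonneg fun y _ => hp t y]
    exact ENNReal.ofReal_le_one.2 (hS t)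
  have hc : ∀ t u, charFun (μs t) u = ∑ y ∈ S t,
      Complex.exp (u * ((y : ℝ) / (t : ℝ) : ℝ) * Complex.I) * p t y := by
    intro t u
    rw [charFun_apply_real, integral_finsetSum_measure]
    · refine Finset.sum_congr rfl fun y _ => ?_
      rw [integral_smul_measure, integral_dirac, ENNReal.toReal_ofReal (hp t y),
        Complex.real_smul, mul_comm]
    · intro y _
      exact (integrable_dirac (by simp)).smul_measure ENNReal.ofReal_ne_top
  have hc0 : ∀ u, charFun μ u = ∫ y : ℝ, Complex.exp (u * y * Complex.I) * ρ y := by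
    intro u
    rw [charFun_apply_real, integral_withDensity_eq_integral_toReal_smul₀
      hρ.1.aemeasurable.ennreal_ofReal (by simp)]
    refine integral_congr_ae (Eventually.of_forall fun y => ?_)
    simp only [ENNReal.toReal_ofReal (hρ0 y), Complex.real_smul, mul_comm]
  -- The limit has a density, hence no atoms, and every `x` is a continuity point.
  have hx : μ {x} = 0 := withDensity_absolutelyContinuous _ _ (by simp)
  have h1 := tendsto_real_Iic_of_tendsto_charFun (μs := μs) (μ := μ) hmass
    (fun u => by simpa only [hc, hc0] using h u) hx
  have h2 : μ.real (Set.Iic x) = ∫ y in Set.Iic x, ρ y := by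
    rw [Measure.real, withDensity_apply _ measurableSet_Iic,
      integral_eq_lintegral_of_nonneg_ae (Eventually.of_forall hρ0) hρ.1.restrict]
  rw [h2] at h1
  refine h1.congr fun t => ?_
  simp only [μs, Measure.real, Measure.finsetSum_apply, Measure.smul_apply, smul_eq_mul]
  rw [ENNReal.toReal_sum, Finset.sum_filter]
  · refine Finset.sum_congr rfl fun y _ => ?_
    rw [Measure.dirac_apply' _ measurableSet_Iic]
    by_cases hy : (y : ℝ) / (t : ℝ) ≤ x <;> simp [hy, hp t y]
  · intro y _
    exact ENNReal.mul_ne_top ENNReal.ofReal_ne_top (measure_ne_top _ _)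

/-! ### The two-step operator in momentum space and its powers -/

/-- Half the trace of the two-step operator in momentum space, i.e. the cosine of the
quasi-energy. -/
noncomputable def halfTrace (θ₁ θ₂ k : ℝ) : ℝ :=
  Real.cos θ₁ * Real.cos θ₂ * Real.cos (2 * k) + Real.sin θ₁ * Real.sin θ₂

/-- The squared modulus of the off-diagonal entry of the two-step operator. -/
noncomputable def offDiagSq (θ₁ θ₂ k : ℝ) : ℝ :=
  (Real.cos θ₁ * Real.sin θ₂) ^ 2 + (Real.cos θ₂ * Real.sin θ₁) ^ 2
    - 2 * (Real.cos θ₁ * Real.sin θ₂) * (Real.cos θ₂ * Real.sin θ₁) * Real.cos (2 * k)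

/-- The sine of the quasi-energy. -/
noncomputable def sinQuasi (θ₁ θ₂ k : ℝ) : ℝ := √(1 - halfTrace θ₁ θ₂ k ^ 2)

/-- The quasi-energy of the two-step operator. -/
noncomputable def quasiEnergy (θ₁ θ₂ k : ℝ) : ℝ := Real.arccos (halfTrace θ₁ θ₂ k)

/-- The diagonal entry of the axis of the two-step operator, which is also half the derivative
of the quasi-energy. -/
noncomputable def velocity (θ₁ θ₂ k : ℝ) : ℝ :=
  Real.cos θ₁ * Real.cos θ₂ * Real.sin (2 * k) / sinQuasi θ₁ θ₂ k

/-- The off-diagonal entry of the axis of the two-step operator. -/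
noncomputable def axisOff (θ₁ θ₂ k : ℝ) : ℂ :=
  (Complex.exp (2 * k * Complex.I) * (Real.cos θ₂ * Real.sin θ₁ : ℝ)
    - (Real.sin θ₂ * Real.cos θ₁ : ℝ)) / (Complex.I * sinQuasi θ₁ θ₂ k)

/-- The axis of the two-step operator, an involution. -/
noncomputable def axisOp (θ₁ θ₂ k : ℝ) (v : Fin 2 → ℂ) : Fin 2 → ℂ :=
  ![velocity θ₁ θ₂ k * v 0 + axisOff θ₁ θ₂ k * v 1,
    starRingEnd ℂ (axisOff θ₁ θ₂ k) * v 0 - velocity θ₁ θ₂ k * v 1]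

/-- The spectral projections `(1 + σ N) / 2` for `σ = ± 1`. -/
noncomputable def branch (σ : ℂ) (θ₁ θ₂ k : ℝ) (v : Fin 2 → ℂ) : Fin 2 → ℂ :=
  fun j => (v j + σ * axisOp θ₁ θ₂ k v j) / 2

/-- One step of the walk in momentum space. -/
noncomputable def stepHat (θ k : ℝ) (v : Fin 2 → ℂ) : Fin 2 → ℂ :=
  ![Complex.exp (k * Complex.I) * (Real.cos θ * v 0 + Real.sin θ * v 1),
    Complex.exp (-(k * Complex.I)) * (Real.sin θ * v 0 - Real.cos θ * v 1)]

/-- `n` double steps of the walk in momentum space. -/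
noncomputable def evolve (θ₁ θ₂ : ℝ) (n : ℕ) (k : ℝ) (v : Fin 2 → ℂ) : Fin 2 → ℂ :=
  (fun w => stepHat θ₂ k (stepHat θ₁ k w))^[n] v

theorem evolve_succ (θ₁ θ₂ : ℝ) (n : ℕ) (k : ℝ) (v : Fin 2 → ℂ) :
    evolve θ₁ θ₂ (n + 1) k v = stepHat θ₂ k (stepHat θ₁ k (evolve θ₁ θ₂ n k v)) :=
  Function.iterate_succ_apply' _ _ _

theorem norm_sq_stepHat (θ k : ℝ) (v : Fin 2 → ℂ) :
    ‖stepHat θ k v 0‖ ^ 2 + ‖stepHat θ k v 1‖ ^ 2 = ‖v 0‖ ^ 2 + ‖v 1‖ ^ 2 := by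
  have h1 : ‖Complex.exp (k * Complex.I)‖ = 1 := Complex.norm_exp_ofReal_mul_I k
  have h2 : ‖Complex.exp (-(k * Complex.I))‖ = 1 := by
    rw [← neg_mul, ← Complex.ofReal_neg]; exact Complex.norm_exp_ofReal_mul_I _
  simp only [stepHat, Matrix.cons_val_zero, Matrix.cons_val_one, norm_mul, h1, h2, one_mul]
  simp only [← Complex.normSq_eq_norm_sq, Complex.normSq_apply]
  simp only [Complex.add_re, Complex.sub_re, Complex.add_im, Complex.sub_im,
    Complex.re_ofReal_mul, Complex.im_ofReal_mul]
  linear_combination ((v 0).re ^ 2 + (v 0).im ^ 2 + (v 1).re ^ 2 + (v 1).im ^ 2) *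
    Real.sin_sq_add_cos_sq θ

theorem norm_sq_evolve (θ₁ θ₂ : ℝ) (n : ℕ) (k : ℝ) (v : Fin 2 → ℂ) :
    ‖evolve θ₁ θ₂ n k v 0‖ ^ 2 + ‖evolve θ₁ θ₂ n k v 1‖ ^ 2 = ‖v 0‖ ^ 2 + ‖v 1‖ ^ 2 := by
  induction n with
  | zero => rfl
  | succ n ih => rw [evolve_succ, norm_sq_stepHat, norm_sq_stepHat, ih]

theorem continuous_stepHat (θ : ℝ) {f : ℝ → Fin 2 → ℂ} (hf : Continuous f) :
    Continuous fun k => stepHat θ k (f k) := by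
  refine continuous_pi fun j => ?_
  fin_cases j <;> simp only [stepHat] <;> simp <;> fun_prop

theorem continuous_evolve (θ₁ θ₂ : ℝ) (n : ℕ) {f : ℝ → Fin 2 → ℂ} (hf : Continuous f) :
    Continuous fun k => evolve θ₁ θ₂ n k (f k) := by
  induction n with
  | zero => exact hf
  | succ n ih =>
    simp_rw [evolve_succ]
    exact continuous_stepHat θ₂ (continuous_stepHat θ₁ ih)

theorem offDiagSq_nonneg (θ₁ θ₂ k : ℝ) : 0 ≤ offDiagSq θ₁ θ₂ k := by
  have h : offDiagSq θ₁ θ₂ k = (Real.cos θ₁ * Real.sin θ₂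
      - Real.cos θ₂ * Real.sin θ₁ * Real.cos (2 * k)) ^ 2
      + (Real.cos θ₂ * Real.sin θ₁ * Real.sin (2 * k)) ^ 2 := by
    unfold offDiagSq
    linear_combination -(Real.cos θ₂ * Real.sin θ₁) ^ 2 * Real.sin_sq_add_cos_sq (2 * k)
  rw [h]; positivity

/-- The first row of an SU(2) matrix has norm one: the diagonal entry `c₁c₂e^{2ik} + s₁s₂` has real
part `halfTrace` and imaginary part `c₁c₂ sin 2k`, and the other entry has squared modulus
`offDiagSq`. -/
theorem one_sub_halfTrace_sq (θ₁ θ₂ k : ℝ) :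
    1 - halfTrace θ₁ θ₂ k ^ 2
      = (Real.cos θ₁ * Real.cos θ₂ * Real.sin (2 * k)) ^ 2 + offDiagSq θ₁ θ₂ k := by
  unfold halfTrace offDiagSq
  have h1 := Real.sin_sq_add_cos_sq θ₁
  have h2 := Real.sin_sq_add_cos_sq θ₂
  have h3 := Real.sin_sq_add_cos_sq (2 * k)
  linear_combination -(Real.cos θ₁ * Real.cos θ₂) ^ 2 * h3 - h1
    - (Real.sin θ₁ ^ 2 + Real.cos θ₁ ^ 2) * h2

theorem one_sub_halfTrace_sq_nonneg (θ₁ θ₂ k : ℝ) : 0 ≤ 1 - halfTrace θ₁ θ₂ k ^ 2 := by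
  rw [one_sub_halfTrace_sq]
  have := offDiagSq_nonneg θ₁ θ₂ k
  positivity

theorem sinQuasi_sq (θ₁ θ₂ k : ℝ) : sinQuasi θ₁ θ₂ k ^ 2 = 1 - halfTrace θ₁ θ₂ k ^ 2 :=
  Real.sq_sqrt (one_sub_halfTrace_sq_nonneg θ₁ θ₂ k)

theorem halfTrace_mem_Icc (θ₁ θ₂ k : ℝ) : halfTrace θ₁ θ₂ k ∈ Set.Icc (-1 : ℝ) 1 := by
  have := one_sub_halfTrace_sq_nonneg θ₁ θ₂ k
  exact abs_le.1 (abs_le_one_iff_mul_self_le_one.2 (by linarith [sq (halfTrace θ₁ θ₂ k)]))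

/-- Away from `sin 2k = 0` the imaginary part of the diagonal entry already keeps the matrix from
being `±1`. The excluded momenta are countable, so all later arguments may ignore them. -/
theorem sinQuasi_pos {θ₁ θ₂ k : ℝ} (h₁ : Real.cos θ₁ ≠ 0) (h₂ : Real.cos θ₂ ≠ 0)
    (hk : Real.sin (2 * k) ≠ 0) : 0 < sinQuasi θ₁ θ₂ k := by
  refine Real.sqrt_pos.2 ?_
  rw [one_sub_halfTrace_sq]
  have := offDiagSq_nonneg θ₁ θ₂ k
  positivity

theorem exp_quasiEnergy (θ₁ θ₂ k : ℝ) : Complex.exp (quasiEnergy θ₁ θ₂ k * Complex.I)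
    = halfTrace θ₁ θ₂ k + sinQuasi θ₁ θ₂ k * Complex.I := by
  obtain ⟨h1, h2⟩ := halfTrace_mem_Icc θ₁ θ₂ k
  rw [Complex.exp_mul_I, ← Complex.ofReal_cos, ← Complex.ofReal_sin, quasiEnergy,
    Real.cos_arccos h1 h2, Real.sin_arccos]
  rfl

theorem exp_two_mul_I (k : ℝ) : Complex.exp (2 * k * Complex.I)
    = (Real.cos (2 * k) : ℂ) + (Real.sin (2 * k) : ℂ) * Complex.I := by
  rw [Complex.exp_mul_I]
  push_cast
  rfl

theorem velocity_mul_sinQuasi {θ₁ θ₂ k : ℝ} (hs : sinQuasi θ₁ θ₂ k ≠ 0) :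
    velocity θ₁ θ₂ k * sinQuasi θ₁ θ₂ k = Real.cos θ₁ * Real.cos θ₂ * Real.sin (2 * k) :=
  div_mul_cancel₀ _ hs

theorem axisOff_eq (θ₁ θ₂ k : ℝ) : axisOff θ₁ θ₂ k
    = ((Real.cos θ₂ * Real.sin θ₁ * Real.sin (2 * k) / sinQuasi θ₁ θ₂ k : ℝ) : ℂ)
      - ((Real.cos θ₂ * Real.sin θ₁ * Real.cos (2 * k) - Real.sin θ₂ * Real.cos θ₁)
        / sinQuasi θ₁ θ₂ k : ℝ) * Complex.I := by
  rw [axisOff, exp_two_mul_I, div_mul_eq_div_div, Complex.div_I]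
  push_cast
  ring_nf
  simp only [Complex.I_sq]
  ring

theorem axisOff_re (θ₁ θ₂ k : ℝ) : (axisOff θ₁ θ₂ k).re
    = Real.cos θ₂ * Real.sin θ₁ * Real.sin (2 * k) / sinQuasi θ₁ θ₂ k := by
  rw [axisOff_eq, Complex.sub_re, Complex.ofReal_re, Complex.re_ofReal_mul]
  simp

theorem axisOff_im (θ₁ θ₂ k : ℝ) : (axisOff θ₁ θ₂ k).im
    = -((Real.cos θ₂ * Real.sin θ₁ * Real.cos (2 * k) - Real.sin θ₂ * Real.cos θ₁)
      / sinQuasi θ₁ θ₂ k) := by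
  rw [axisOff_eq, Complex.sub_im, Complex.ofReal_im, Complex.im_ofReal_mul]
  simp

/-- The identity `one_sub_halfTrace_sq` divided by `sin² ω`: the axis has unit length, which makes
it an involution and bounds its entries. -/
theorem velocity_sq_add_normSq_axisOff {θ₁ θ₂ k : ℝ} (hs : sinQuasi θ₁ θ₂ k ≠ 0) :
    velocity θ₁ θ₂ k ^ 2 + Complex.normSq (axisOff θ₁ θ₂ k) = 1 := by
  rw [Complex.normSq_apply, axisOff_re, axisOff_im, velocity]
  have h := sinQuasi_sq θ₁ θ₂ k
  rw [one_sub_halfTrace_sq, offDiagSq] at h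
  field_simp
  rw [h]
  linear_combination (Real.cos θ₂ * Real.sin θ₁) ^ 2 * Real.sin_sq_add_cos_sq (2 * k)

theorem velocity_sq_add_axisOff_mul_conj {θ₁ θ₂ k : ℝ} (hs : sinQuasi θ₁ θ₂ k ≠ 0) :
    (velocity θ₁ θ₂ k : ℂ) ^ 2 + axisOff θ₁ θ₂ k * starRingEnd ℂ (axisOff θ₁ θ₂ k) = 1 := by
  rw [Complex.mul_conj]
  exact_mod_cast velocity_sq_add_normSq_axisOff hs

theorem axisOp_axisOp {θ₁ θ₂ k : ℝ} (hs : sinQuasi θ₁ θ₂ k ≠ 0) (v : Fin 2 → ℂ) :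
    axisOp θ₁ θ₂ k (axisOp θ₁ θ₂ k v) = v := by
  have h := velocity_sq_add_axisOff_mul_conj hs
  ext j
  fin_cases j
  · simp [axisOp]
    linear_combination v 0 * h
  · simp [axisOp]
    linear_combination v 1 * h

theorem axisOff_mul {θ₁ θ₂ k : ℝ} (hs : sinQuasi θ₁ θ₂ k ≠ 0) :
    Complex.I * sinQuasi θ₁ θ₂ k * axisOff θ₁ θ₂ k =
      Complex.exp (2 * k * Complex.I) * (Real.cos θ₂ * Real.sin θ₁ : ℝ)
        - (Real.sin θ₂ * Real.cos θ₁ : ℝ) := by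
  have : (sinQuasi θ₁ θ₂ k : ℂ) ≠ 0 := by exact_mod_cast hs
  rw [axisOff]
  field_simp [Complex.I_ne_zero]

/-- The decomposition `cos ω + i sin ω · N` of an SU(2) matrix into half its trace and a traceless
Hermitian part. -/
theorem double_step {θ₁ θ₂ k : ℝ} (hs : sinQuasi θ₁ θ₂ k ≠ 0) (v : Fin 2 → ℂ) (j : Fin 2) :
    stepHat θ₂ k (stepHat θ₁ k v) j
      = halfTrace θ₁ θ₂ k * v j + Complex.I * sinQuasi θ₁ θ₂ k * axisOp θ₁ θ₂ k v j := by
  have h1 := axisOff_mul hs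
  have h2 : (velocity θ₁ θ₂ k : ℂ) * sinQuasi θ₁ θ₂ k
      = Real.cos θ₁ * Real.cos θ₂ * Real.sin (2 * k) := by
    exact_mod_cast velocity_mul_sinQuasi hs
  -- The second row of an SU(2) matrix consists of conjugates of the first up to sign, so its
  -- identities `h3` and `e5` are conjugates of `h1` and `e4`.
  have h3 := congrArg (starRingEnd ℂ) h1
  simp only [map_mul, map_sub, Complex.conj_I, Complex.conj_ofReal, ← Complex.exp_conj,
    map_ofNat] at h3
  have e1 : Complex.exp (k * Complex.I) * Complex.exp (k * Complex.I)
      = Complex.exp (2 * k * Complex.I) := by rw [← Complex.exp_add]; ring_nf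
  have e2 : Complex.exp (k * Complex.I) * Complex.exp (-(k * Complex.I)) = 1 := by
    rw [← Complex.exp_add]; simp
  have e3 : Complex.exp (-(k * Complex.I)) * Complex.exp (-(k * Complex.I))
      = Complex.exp (2 * k * -Complex.I) := by rw [← Complex.exp_add]; ring_nf
  have e4 := exp_two_mul_I k
  have e5 := congrArg (starRingEnd ℂ) e4
  simp only [map_mul, map_add, Complex.conj_I, Complex.conj_ofReal, ← Complex.exp_conj,
    map_ofNat] at e5
  have hW : (halfTrace θ₁ θ₂ k : ℂ) = Real.cos θ₁ * Real.cos θ₂ * Real.cos (2 * k)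
      + Real.sin θ₁ * Real.sin θ₂ := by
    rw [halfTrace]; push_cast; rfl
  push_cast [-Complex.ofReal_cos, -Complex.ofReal_sin] at h1 h3
  fin_cases j
  · simp only [stepHat, axisOp, Fin.zero_eta, Matrix.cons_val_zero, Matrix.cons_val_one]
    rw [hW]
    linear_combination (Real.cos θ₂ : ℂ) * (Real.cos θ₁ * v 0 + Real.sin θ₁ * v 1) * e1
      + (Real.sin θ₂ : ℂ) * (Real.sin θ₁ * v 0 - Real.cos θ₁ * v 1) * e2
      - v 1 * h1 - Complex.I * v 0 * h2 + (Real.cos θ₁ * Real.cos θ₂ * v 0 : ℂ) * e4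
  · simp only [stepHat, axisOp, Fin.mk_one, Matrix.cons_val_zero, Matrix.cons_val_one]
    rw [hW]
    linear_combination (-Real.cos θ₂ : ℂ) * (Real.sin θ₁ * v 0 - Real.cos θ₁ * v 1) * e3
      + (Real.sin θ₂ : ℂ) * (Real.cos θ₁ * v 0 + Real.sin θ₁ * v 1) * e2
      + v 0 * h3 + Complex.I * v 1 * h2 + (Real.cos θ₁ * Real.cos θ₂ * v 1 : ℂ) * e5

/-- Since `N² = 1`, the vector `(1 + σN)v/2` is an eigenvector of `N` for `σ`, and the double step
multiplies it by `cos ω + iσ sin ω`. -/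
theorem double_step_branch {θ₁ θ₂ k : ℝ} (hs : sinQuasi θ₁ θ₂ k ≠ 0) {σ : ℂ} (hσ : σ ^ 2 = 1)
    (v : Fin 2 → ℂ) : stepHat θ₂ k (stepHat θ₁ k (branch σ θ₁ θ₂ k v))
      = fun j => (halfTrace θ₁ θ₂ k + σ * (sinQuasi θ₁ θ₂ k * Complex.I))
        * branch σ θ₁ θ₂ k v j := by
  have h1 : axisOp θ₁ θ₂ k (branch σ θ₁ θ₂ k v) = fun j => σ * branch σ θ₁ θ₂ k v j := by
    have h2 := axisOp_axisOp hs v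
    have h3 : ∀ j, axisOp θ₁ θ₂ k (branch σ θ₁ θ₂ k v) j
        = (axisOp θ₁ θ₂ k v j + σ * axisOp θ₁ θ₂ k (axisOp θ₁ θ₂ k v) j) / 2 := by
      intro j
      fin_cases j <;> simp [axisOp, branch] <;> ring
    ext j
    rw [h3, h2]
    simp only [branch]
    linear_combination (-(axisOp θ₁ θ₂ k v j) / 2) * hσ
  ext j
  rw [double_step hs, h1]
  ring

theorem evolve_eq {θ₁ θ₂ k : ℝ} (hs : sinQuasi θ₁ θ₂ k ≠ 0) (n : ℕ) (v : Fin 2 → ℂ)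
    (j : Fin 2) : evolve θ₁ θ₂ n k v j
      = Complex.exp ((n * quasiEnergy θ₁ θ₂ k : ℝ) * Complex.I) * branch 1 θ₁ θ₂ k v j
        + Complex.exp (-((n * quasiEnergy θ₁ θ₂ k : ℝ) * Complex.I))
          * branch (-1) θ₁ θ₂ k v j := by
  have hadd : ∀ a b : Fin 2 → ℂ, stepHat θ₂ k (stepHat θ₁ k (fun j => a j + b j))
      = fun j => stepHat θ₂ k (stepHat θ₁ k a) j + stepHat θ₂ k (stepHat θ₁ k b) j := by
    intro a b
    ext j
    fin_cases j <;> simp [stepHat] <;> ring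
  have hmul : ∀ (c : ℂ) (a : Fin 2 → ℂ), stepHat θ₂ k (stepHat θ₁ k (fun j => c * a j))
      = fun j => c * stepHat θ₂ k (stepHat θ₁ k a) j := by
    intro c a
    ext j
    fin_cases j <;> simp [stepHat] <;> ring
  have e1 := exp_quasiEnergy θ₁ θ₂ k
  have e2 : Complex.exp (-(quasiEnergy θ₁ θ₂ k * Complex.I))
      = halfTrace θ₁ θ₂ k + (-1) * (sinQuasi θ₁ θ₂ k * Complex.I) := by
    have h := congrArg (starRingEnd ℂ) e1
    simp only [← Complex.exp_conj, map_mul, map_add, Complex.conj_I, Complex.conj_ofReal] at h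
    rw [mul_neg] at h
    rw [h]
    ring
  revert j
  rw [← funext_iff]
  induction n with
  | zero =>
    ext j
    simp [evolve, branch]
    ring
  | succ n ih =>
    rw [evolve_succ, ih, hadd, hmul, hmul, double_step_branch hs (by norm_num),
      double_step_branch hs (by norm_num), one_mul, ← e1, ← e2]
    ext j
    have e3 : ((n + 1 : ℕ) * quasiEnergy θ₁ θ₂ k : ℝ) * Complex.I
        = (n * quasiEnergy θ₁ θ₂ k : ℝ) * Complex.I + quasiEnergy θ₁ θ₂ k * Complex.I := by
      push_cast; ring
    rw [e3, neg_add, Complex.exp_add, Complex.exp_add]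
    ring

/-! ### Regularity and bounds of the spectral data -/

theorem continuous_halfTrace (θ₁ θ₂ : ℝ) : Continuous (halfTrace θ₁ θ₂) := by
  unfold halfTrace; fun_prop

theorem continuous_sinQuasi (θ₁ θ₂ : ℝ) : Continuous (sinQuasi θ₁ θ₂) := by
  have := continuous_halfTrace θ₁ θ₂
  unfold sinQuasi; fun_prop

theorem continuousAt_velocity {θ₁ θ₂ k : ℝ} (hs : sinQuasi θ₁ θ₂ k ≠ 0) :
    ContinuousAt (velocity θ₁ θ₂) k := by
  have := (continuous_sinQuasi θ₁ θ₂).continuousAt (x := k)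
  unfold velocity
  exact ContinuousAt.div (by fun_prop) this hs

theorem continuousAt_axisOff {θ₁ θ₂ k : ℝ} (hs : sinQuasi θ₁ θ₂ k ≠ 0) :
    ContinuousAt (axisOff θ₁ θ₂) k := by
  have := (continuous_sinQuasi θ₁ θ₂).continuousAt (x := k)
  unfold axisOff
  refine ContinuousAt.div (by fun_prop) (by fun_prop) ?_
  exact mul_ne_zero Complex.I_ne_zero (by exact_mod_cast hs)

theorem measurable_velocity (θ₁ θ₂ : ℝ) : Measurable (velocity θ₁ θ₂) := by
  have := (continuous_sinQuasi θ₁ θ₂).measurable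
  unfold velocity
  fun_prop

theorem measurable_axisOff (θ₁ θ₂ : ℝ) : Measurable (axisOff θ₁ θ₂) := by
  have := (continuous_sinQuasi θ₁ θ₂).measurable
  unfold axisOff
  fun_prop

theorem continuousAt_branch {θ₁ θ₂ k : ℝ} (hs : sinQuasi θ₁ θ₂ k ≠ 0) (σ : ℂ)
    {φ : ℝ → Fin 2 → ℂ} (hφ : Continuous φ) (j : Fin 2) :
    ContinuousAt (fun k => branch σ θ₁ θ₂ k (φ k) j) k := by
  have h1 := continuousAt_velocity hs
  have h2 := continuousAt_axisOff hs
  have h3 : ∀ i, ContinuousAt (fun k => φ k i) k := fun i => by fun_prop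
  have h4 := h3 0
  have h5 := h3 1
  fin_cases j <;> simp only [branch, axisOp] <;> simp <;> fun_prop

theorem measurable_branch (θ₁ θ₂ : ℝ) (σ : ℂ) {φ : ℝ → Fin 2 → ℂ} (hφ : Continuous φ)
    (j : Fin 2) : Measurable (fun k => branch σ θ₁ θ₂ k (φ k) j) := by
  have h1 := measurable_velocity θ₁ θ₂
  have h2 := measurable_axisOff θ₁ θ₂
  have h3 := hφ.measurable
  have h4 : ∀ i, Measurable (fun k => φ k i) := fun i => by fun_prop
  have h5 := h4 0
  have h6 := h4 1
  have h7 : Measurable (fun k => starRingEnd ℂ (axisOff θ₁ θ₂ k)) :=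
    Complex.continuous_conj.measurable.comp h2
  fin_cases j <;> simp only [branch, axisOp] <;> simp <;> fun_prop

theorem continuous_quasiEnergy (θ₁ θ₂ : ℝ) : Continuous (quasiEnergy θ₁ θ₂) :=
  Real.continuous_arccos.comp (continuous_halfTrace θ₁ θ₂)

theorem hasDerivAt_quasiEnergy {θ₁ θ₂ k : ℝ} (hs : sinQuasi θ₁ θ₂ k ≠ 0) :
    HasDerivAt (quasiEnergy θ₁ θ₂) (2 * velocity θ₁ θ₂ k) k := by
  have h0 : HasDerivAt (fun k : ℝ => 2 * k) 2 k := by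
    simpa using (hasDerivAt_id k).const_mul (2 : ℝ)
  have h1 : HasDerivAt (halfTrace θ₁ θ₂)
      (Real.cos θ₁ * Real.cos θ₂ * (-Real.sin (2 * k) * 2)) k :=
    (h0.cos.const_mul _).add_const _
  have h2 : halfTrace θ₁ θ₂ k ^ 2 ≠ 1 := by
    intro h
    apply hs
    simp [sinQuasi, h]
  have h3 := (Real.hasDerivAt_arccos (x := halfTrace θ₁ θ₂ k) (by rintro h; simp [h] at h2)
    (by rintro h; simp [h] at h2)).comp k h1
  refine HasDerivAt.congr_deriv (f := quasiEnergy θ₁ θ₂) h3 ?_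
  rw [velocity, sinQuasi]
  ring

/-- A crude bound, used for integrability and domination: the entries of `N` have modulus at most
one, so `(C + 2C)/2 ≤ 2C`. -/
theorem norm_branch_le {θ₁ θ₂ k : ℝ} (hs : sinQuasi θ₁ θ₂ k ≠ 0) {σ : ℂ} (hσ : ‖σ‖ = 1)
    {v : Fin 2 → ℂ} {C : ℝ} (hC : ‖v 0‖ ^ 2 + ‖v 1‖ ^ 2 ≤ C ^ 2) (hC0 : 0 ≤ C) (j : Fin 2) :
    ‖branch σ θ₁ θ₂ k v j‖ ≤ 2 * C := by
  have hv : ∀ i, ‖v i‖ ≤ C := by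
    intro i
    refine abs_le_of_sq_le_sq' ?_ hC0 |>.2
    fin_cases i <;> simp <;> nlinarith [sq_nonneg ‖v 0‖, sq_nonneg ‖v 1‖]
  have h := velocity_sq_add_normSq_axisOff hs
  rw [Complex.normSq_eq_norm_sq] at h
  have hn : ‖(velocity θ₁ θ₂ k : ℂ)‖ ≤ 1 := by
    rw [Complex.norm_real]
    refine (abs_le_of_sq_le_sq' (b := 1) ?_ zero_le_one).2
    rw [Real.norm_eq_abs, sq_abs]
    nlinarith [sq_nonneg ‖axisOff θ₁ θ₂ k‖]
  have hm : ‖axisOff θ₁ θ₂ k‖ ≤ 1 :=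
    (abs_le_of_sq_le_sq' (b := 1) (by nlinarith [sq_nonneg (velocity θ₁ θ₂ k)]) zero_le_one).2
  have hA : ‖axisOp θ₁ θ₂ k v j‖ ≤ C + C := by
    fin_cases j
    · refine (norm_add_le _ _).trans (add_le_add ?_ ?_) <;> rw [norm_mul]
      · exact (mul_le_of_le_one_left (norm_nonneg _) hn).trans (hv 0)
      · exact (mul_le_of_le_one_left (norm_nonneg _) hm).trans (hv 1)
    · refine (norm_sub_le _ _).trans (add_le_add ?_ ?_) <;> rw [norm_mul]
      · rw [RCLike.norm_conj]
        exact (mul_le_of_le_one_left (norm_nonneg _) hm).trans (hv 0)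
      · exact (mul_le_of_le_one_left (norm_nonneg _) hn).trans (hv 1)
  rw [branch, norm_div, RCLike.norm_ofNat]
  have h1 : ‖v j + σ * axisOp θ₁ θ₂ k v j‖ ≤ C + (C + C) := by
    refine (norm_add_le _ _).trans (add_le_add (hv j) ?_)
    rwa [norm_mul, hσ, one_mul]
  linarith

/-! ### Decay of integrals oscillating with the quasi-energy -/

theorem ae_sin_two_mul_ne_zero : ∀ᵐ k : ℝ, Real.sin (2 * k) ≠ 0 := by
  have h : {k : ℝ | Real.sin (2 * k) = 0} ⊆ Set.range fun n : ℤ => (n : ℝ) * Real.pi / 2 := by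
    intro k hk
    obtain ⟨n, hn⟩ := Real.sin_eq_zero_iff.1 hk
    exact ⟨n, by simp only [hn]; ring⟩
  have h1 : volume {k : ℝ | Real.sin (2 * k) = 0} = 0 :=
    ((Set.countable_range _).mono h).measure_zero _
  simpa [ae_iff] using h1

/-- On a quarter of the momentum circle `2k` runs through a single half period of the cosine, so `ω`
is injective there with derivative `2v ≠ 0`. -/
theorem tendsto_integral_exp_quasiEnergy_piece {θ₁ θ₂ : ℝ} (h₁ : Real.cos θ₁ ≠ 0)
    (h₂ : Real.cos θ₂ ≠ 0) (m : ℤ) (g : ℝ → ℂ) :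
    Tendsto (fun w : ℝ => ∫ k in (m * (Real.pi / 2))..((m + 1) * (Real.pi / 2)),
      Complex.exp (w * quasiEnergy θ₁ θ₂ k * Complex.I) * g k) (cocompact ℝ) (𝓝 0) := by
  have hpi := Real.pi_pos
  simp_rw [intervalIntegral.integral_of_le (show (m : ℝ) * (Real.pi / 2) ≤ (m + 1) * (Real.pi / 2)
    by nlinarith), integral_Ioc_eq_integral_Ioo]
  have hmem : ∀ k ∈ Set.Ioo ((m : ℝ) * (Real.pi / 2)) ((m + 1) * (Real.pi / 2)),
      2 * k - m * Real.pi ∈ Set.Ioo 0 Real.pi := by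
    rintro k ⟨hk1, hk2⟩
    constructor <;> linarith
  have hsin : ∀ k ∈ Set.Ioo ((m : ℝ) * (Real.pi / 2)) ((m + 1) * (Real.pi / 2)),
      Real.sin (2 * k) ≠ 0 := by
    intro k hk h0
    have h := (Real.sin_pos_of_mem_Ioo (hmem k hk)).ne'
    rw [Real.sin_sub_int_mul_pi, h0, mul_zero] at h
    exact h rfl
  refine tendsto_setIntegral_exp_phase measurableSet_Ioo
    (f' := fun k => 2 * velocity θ₁ θ₂ k) ?_ ?_ ?_ g
  · intro k hk
    exact (hasDerivAt_quasiEnergy (sinQuasi_pos h₁ h₂ (hsin k hk)).ne').hasDerivWithinAt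
  · intro k hk k' hk' h
    have h3 := Real.arccos_injOn (halfTrace_mem_Icc _ _ _) (halfTrace_mem_Icc _ _ _) h
    have h4 : Real.cos (2 * k) = Real.cos (2 * k') :=
      mul_left_cancel₀ (mul_ne_zero h₁ h₂) (add_right_cancel h3)
    have h5 : Real.cos (2 * k - m * Real.pi) = Real.cos (2 * k' - m * Real.pi) := by
      rw [Real.cos_sub_int_mul_pi, Real.cos_sub_int_mul_pi, h4]
    have h6 := Real.injOn_cos (Set.Ioo_subset_Icc_self (hmem k hk))
      (Set.Ioo_subset_Icc_self (hmem k' hk')) h5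
    linarith
  · intro k hk
    exact mul_ne_zero two_ne_zero (div_ne_zero (mul_ne_zero (mul_ne_zero h₁ h₂) (hsin k hk))
      (sinQuasi_pos h₁ h₂ (hsin k hk)).ne')

theorem tendsto_integral_exp_quasiEnergy {θ₁ θ₂ : ℝ} (h₁ : Real.cos θ₁ ≠ 0)
    (h₂ : Real.cos θ₂ ≠ 0) {g : ℝ → ℂ} (hg : ∀ a b : ℝ, IntervalIntegrable g volume a b) :
    Tendsto (fun w : ℝ => ∫ k in (-Real.pi)..Real.pi,
      Complex.exp (w * quasiEnergy θ₁ θ₂ k * Complex.I) * g k) (cocompact ℝ) (𝓝 0) := by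
  have hi : ∀ (w a b : ℝ), IntervalIntegrable
      (fun k => Complex.exp (w * quasiEnergy θ₁ θ₂ k * Complex.I) * g k) volume a b := by
    intro w a b
    have := continuous_quasiEnergy θ₁ θ₂
    exact (hg a b).continuousOn_mul (by fun_prop)
  have hp := tendsto_integral_exp_quasiEnergy_piece h₁ h₂ (g := g)
  -- The four pieces `m = -2, -1, 0, 1` tile the interval from `-π` to `π`; integrability of `g`
  -- serves only to glue them.
  have hsum := (((hp (-2)).add (hp (-1))).add (hp 0)).add (hp 1)
  simp only [add_zero] at hsum
  refine hsum.congr fun w => ?_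
  norm_num
  have e1 : -(2 * (Real.pi / 2)) = -Real.pi := by ring
  have e2 : 2 * (Real.pi / 2) = Real.pi := by ring
  rw [e1, e2, intervalIntegral.integral_add_adjacent_intervals (hi _ _ _) (hi _ _ _),
    intervalIntegral.integral_add_adjacent_intervals (hi _ _ _) (hi _ _ _),
    intervalIntegral.integral_add_adjacent_intervals (hi _ _ _) (hi _ _ _)]

/-! ### The limit of the characteristic function in momentum space -/

theorem norm_exp_ofReal_mul_ofReal_mul_I (a b : ℝ) : ‖Complex.exp (a * b * Complex.I)‖ = 1 := by
  rw [← Complex.ofReal_mul, Complex.norm_exp_ofReal_mul_I]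

/-- The non-oscillating part of the integrand of the characteristic function. -/
noncomputable def stationary (θ₁ θ₂ u : ℝ) (φ : ℝ → Fin 2 → ℂ) (j : Fin 2) (k : ℝ) : ℂ :=
  Complex.exp ((-u : ℝ) * velocity θ₁ θ₂ k * Complex.I)
      * (starRingEnd ℂ (branch 1 θ₁ θ₂ k (φ k) j) * branch 1 θ₁ θ₂ k (φ k) j)
    + Complex.exp (u * velocity θ₁ θ₂ k * Complex.I)
      * (starRingEnd ℂ (branch (-1) θ₁ θ₂ k (φ k) j) * branch (-1) θ₁ θ₂ k (φ k) j)

/-- The amplitude of `exp (2 i n ω)` in the integrand of the characteristic function, for the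
pair of branches `σ, -σ`. -/
noncomputable def crossTerm (σ : ℝ) (θ₁ θ₂ u : ℝ) (φ : ℝ → Fin 2 → ℂ) (j : Fin 2) (k : ℝ) : ℂ :=
  Complex.exp ((-(σ * u) : ℝ) * velocity θ₁ θ₂ k * Complex.I)
      * (starRingEnd ℂ (branch (-σ) θ₁ θ₂ k (φ k) j) * branch σ θ₁ θ₂ k (φ k) j)

theorem measurable_crossTerm (σ θ₁ θ₂ u : ℝ) {φ : ℝ → Fin 2 → ℂ} (hφ : Continuous φ)
    (j : Fin 2) : Measurable (crossTerm σ θ₁ θ₂ u φ j) := by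
  have h1 := measurable_velocity θ₁ θ₂
  have h2 := measurable_branch θ₁ θ₂ σ hφ j
  have h3 := Complex.continuous_conj.measurable.comp (measurable_branch θ₁ θ₂ (-σ) hφ j)
  simp only [Function.comp_def] at h3
  unfold crossTerm
  fun_prop

theorem measurable_stationary (θ₁ θ₂ u : ℝ) {φ : ℝ → Fin 2 → ℂ} (hφ : Continuous φ)
    (j : Fin 2) : Measurable (stationary θ₁ θ₂ u φ j) := by
  have h1 := measurable_velocity θ₁ θ₂
  have h2 := measurable_branch θ₁ θ₂ 1 hφ j
  have h3 := Complex.continuous_conj.measurable.comp (measurable_branch θ₁ θ₂ 1 hφ j)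
  have h4 := measurable_branch θ₁ θ₂ (-1) hφ j
  have h5 := Complex.continuous_conj.measurable.comp (measurable_branch θ₁ θ₂ (-1) hφ j)
  simp only [Function.comp_def] at h3 h5
  unfold stationary
  fun_prop

theorem norm_crossTerm_le {σ θ₁ θ₂ u k : ℝ} (hs : sinQuasi θ₁ θ₂ k ≠ 0) (hσ : |σ| = 1)
    {φ : ℝ → Fin 2 → ℂ} {C : ℝ} (hC : ‖φ k 0‖ ^ 2 + ‖φ k 1‖ ^ 2 ≤ C ^ 2) (hC0 : 0 ≤ C)
    (j : Fin 2) : ‖crossTerm σ θ₁ θ₂ u φ j k‖ ≤ (2 * C) * (2 * C) := by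
  rw [crossTerm, norm_mul, norm_exp_ofReal_mul_ofReal_mul_I, one_mul, norm_mul, RCLike.norm_conj]
  exact mul_le_mul (norm_branch_le hs (by simpa using hσ) hC hC0 j)
    (norm_branch_le hs (by simpa using hσ) hC hC0 j) (norm_nonneg _) (by positivity)

theorem norm_stationary_le {θ₁ θ₂ u k : ℝ} (hs : sinQuasi θ₁ θ₂ k ≠ 0)
    {φ : ℝ → Fin 2 → ℂ} {C : ℝ} (hC : ‖φ k 0‖ ^ 2 + ‖φ k 1‖ ^ 2 ≤ C ^ 2) (hC0 : 0 ≤ C)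
    (j : Fin 2) : ‖stationary θ₁ θ₂ u φ j k‖ ≤ (2 * C) * (2 * C) + (2 * C) * (2 * C) := by
  refine (norm_add_le _ _).trans (add_le_add ?_ ?_) <;>
  · rw [norm_mul, norm_exp_ofReal_mul_ofReal_mul_I, one_mul, norm_mul, RCLike.norm_conj]
    exact mul_le_mul (norm_branch_le hs (by simp) hC hC0 j)
      (norm_branch_le hs (by simp) hC hC0 j) (norm_nonneg _) (by positivity)

theorem intervalIntegrable_of_ae_bound {g : ℝ → ℂ} (hg : Measurable g) {M : ℝ}
    (h : ∀ᵐ k : ℝ, ‖g k‖ ≤ M) (a b : ℝ) : IntervalIntegrable g volume a b := by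
  refine (intervalIntegrable_const (c := M)).mono_fun hg.aestronglyMeasurable ?_
  refine ae_restrict_of_ae (h.mono fun k hk => ?_)
  exact hk.trans (le_abs_self M)

/-- The phase picked up by a branch under the shift of the momentum by `u / T`. -/
theorem tendsto_phase {θ₁ θ₂ k : ℝ} (hs : sinQuasi θ₁ θ₂ k ≠ 0) {T : ℕ → ℝ}
    (hT : Tendsto T atTop atTop) (hr : Tendsto (fun n : ℕ => (n : ℝ) / T n) atTop (𝓝 (1 / 2)))
    (u : ℝ) : Tendsto (fun n : ℕ => (n : ℝ) * (quasiEnergy θ₁ θ₂ (k - u / T n)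
      - quasiEnergy θ₁ θ₂ k)) atTop (𝓝 (-u * velocity θ₁ θ₂ k)) := by
  have h := (hasDerivAt_quasiEnergy hs).hasFDerivAt.hasFDerivWithinAt (s := Set.univ)
  -- The limit `1/2` of `n / T n` cancels the factor `2` in `ω' = 2v`.
  have hd : Tendsto (fun n : ℕ => (n : ℝ) • (-(u / T n))) atTop (𝓝 (-u * (1 / 2))) := by
    refine (hr.const_mul (-u)).congr fun n => ?_
    simp only [smul_eq_mul]; ring
  have hd0 : Tendsto (fun n : ℕ => -(u / T n)) atTop (𝓝 0) := by
    simpa using (hT.const_div_atTop u).neg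
  have h2 := h.lim hd0 (by simp) hd
  simp only [smul_eq_mul, ContinuousLinearMap.toSpanSingleton_apply, ← sub_eq_add_neg] at h2
  rwa [show -u * velocity θ₁ θ₂ k = -u * (1 / 2) * (2 * velocity θ₁ θ₂ k) by ring]

/-- Expanding both amplitudes by `evolve_eq` gives four products. In each, the phase at `k - u/T` is
the phase at `k` times a factor converging by `tendsto_phase`, and the branches converge by
continuity. Replacing these by their limits leaves two non-oscillating terms and two that carry
`e^{±2inω(k)}`. -/
theorem tendsto_integrand_sub {θ₁ θ₂ : ℝ} (h₁ : Real.cos θ₁ ≠ 0) (h₂ : Real.cos θ₂ ≠ 0)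
    {φ : ℝ → Fin 2 → ℂ} (hφ : Continuous φ) {T : ℕ → ℝ}
    (hT : Tendsto T atTop atTop) (hr : Tendsto (fun n : ℕ => (n : ℝ) / T n) atTop (𝓝 (1 / 2)))
    (u : ℝ) (j : Fin 2) {k : ℝ} (hk : Real.sin (2 * k) ≠ 0) :
    Tendsto (fun n : ℕ => starRingEnd ℂ (evolve θ₁ θ₂ n k (φ k) j)
        * evolve θ₁ θ₂ n (k - u / T n) (φ (k - u / T n)) j
      - (stationary θ₁ θ₂ u φ j k
        + Complex.exp ((2 * n : ℝ) * quasiEnergy θ₁ θ₂ k * Complex.I)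
          * crossTerm 1 θ₁ θ₂ u φ j k
        + Complex.exp ((-(2 * n) : ℝ) * quasiEnergy θ₁ θ₂ k * Complex.I)
          * crossTerm (-1) θ₁ θ₂ u φ j k)) atTop (𝓝 0) := by
  have hs := (sinQuasi_pos h₁ h₂ hk).ne'
  have hk' : Tendsto (fun n : ℕ => k - u / T n) atTop (𝓝 k) := by
    simpa using (hT.const_div_atTop u).const_sub k
  have hev : ∀ᶠ n : ℕ in atTop, sinQuasi θ₁ θ₂ (k - u / T n) ≠ 0 :=
    (((continuous_sinQuasi θ₁ θ₂).tendsto k).comp hk').eventually_ne hs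
  have hph := tendsto_phase hs hT hr u
  set p : ℕ → ℝ := fun n => (n : ℝ) * (quasiEnergy θ₁ θ₂ (k - u / T n) - quasiEnergy θ₁ θ₂ k)
    with hp
  have hq : Tendsto (fun n => Complex.exp (p n * Complex.I)) atTop
      (𝓝 (Complex.exp ((-u : ℝ) * velocity θ₁ θ₂ k * Complex.I))) := by
    have : Continuous fun x : ℝ => Complex.exp (x * Complex.I) := by fun_prop
    have h := (this.tendsto _).comp hph
    rw [Complex.ofReal_mul] at h
    exact h
  have hq' : Tendsto (fun n => Complex.exp (-(p n * Complex.I))) atTop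
      (𝓝 (Complex.exp (u * velocity θ₁ θ₂ k * Complex.I))) := by
    have : Continuous fun x : ℝ => Complex.exp (-(x * Complex.I)) := by fun_prop
    have h := (this.tendsto _).comp hph
    rw [Complex.ofReal_mul, Complex.ofReal_neg, neg_mul, neg_mul, neg_neg] at h
    exact h
  have hb : ∀ σ : ℂ, Tendsto (fun n => branch σ θ₁ θ₂ (k - u / T n) (φ (k - u / T n)) j) atTop
      (𝓝 (branch σ θ₁ θ₂ k (φ k) j)) := fun σ =>
    (continuousAt_branch hs σ hφ j).tendsto.comp hk'
  set bp := branch 1 θ₁ θ₂ k (φ k) j with hbp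
  set bm := branch (-1) θ₁ θ₂ k (φ k) j with hbm
  -- A unimodular factor, however it oscillates, does not disturb convergence to zero.
  have hz : ∀ {a : ℕ → ℂ} {l : ℂ}, Tendsto a atTop (𝓝 l) → ∀ w : ℕ → ℝ,
      Tendsto (fun n => Complex.exp (w n * quasiEnergy θ₁ θ₂ k * Complex.I) * (a n - l))
        atTop (𝓝 0) := by
    intro a l ha w
    rw [tendsto_zero_iff_norm_tendsto_zero]
    simp_rw [norm_mul, norm_exp_ofReal_mul_ofReal_mul_I, one_mul]
    rw [← tendsto_zero_iff_norm_tendsto_zero]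
    simpa using ha.sub_const l
  have t1 := hz (hq.mul ((hb 1).const_mul (starRingEnd ℂ bp))) 0
  have t2 := hz (hq'.mul ((hb (-1)).const_mul (starRingEnd ℂ bm))) 0
  have t3 := hz (hq.mul ((hb 1).const_mul (starRingEnd ℂ bm))) (fun n => 2 * n)
  have t4 := hz (hq'.mul ((hb (-1)).const_mul (starRingEnd ℂ bp))) (fun n => -(2 * n))
  have hsum := ((t1.add t2).add t3).add t4
  simp only [add_zero] at hsum
  refine hsum.congr' ?_
  filter_upwards [hev] with n hn
  rw [evolve_eq hs, evolve_eq hn]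
  simp only [stationary, crossTerm, Pi.zero_apply, ← hbp, ← hbm, Complex.ofReal_zero, zero_mul,
    Complex.exp_zero, one_mul, Complex.ofReal_one, Complex.ofReal_neg, neg_neg, map_add, map_mul,
    ← Complex.exp_conj, Complex.conj_I, Complex.conj_ofReal, map_neg, neg_mul, mul_neg]
  set ω := quasiEnergy θ₁ θ₂ k
  set ω' := quasiEnergy θ₁ θ₂ (k - u / T n)
  have e1 : Complex.exp ((n * ω' : ℝ) * Complex.I)
      = Complex.exp ((n * ω : ℝ) * Complex.I) * Complex.exp (p n * Complex.I) := by
    rw [← Complex.exp_add]; simp only [hp, ω']; congr 1; push_cast; ring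
  have e2 : Complex.exp (-((n * ω' : ℝ) * Complex.I))
      = Complex.exp (-((n * ω : ℝ) * Complex.I)) * Complex.exp (-(p n * Complex.I)) := by
    rw [← Complex.exp_add]; simp only [hp, ω']; congr 1; push_cast; ring
  have e3 : Complex.exp ((2 * n : ℝ) * ω * Complex.I)
      = Complex.exp ((n * ω : ℝ) * Complex.I) ^ 2 := by
    rw [← Complex.exp_nat_mul]; push_cast; ring_nf
  have e4 : Complex.exp (-((2 * n : ℝ) * ω * Complex.I))
      = Complex.exp (-((n * ω : ℝ) * Complex.I)) ^ 2 := by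
    rw [← Complex.exp_nat_mul]; push_cast; ring_nf
  have e5 : Complex.exp ((n * ω : ℝ) * Complex.I) * Complex.exp (-((n * ω : ℝ) * Complex.I))
      = 1 := by rw [← Complex.exp_add]; simp
  rw [e1, e2, e3, e4]
  generalize Complex.exp ((n * ω : ℝ) * Complex.I) = E at e5 ⊢
  generalize Complex.exp (-((n * ω : ℝ) * Complex.I)) = E' at e5 ⊢
  generalize branch 1 θ₁ θ₂ (k - u / T n) (φ (k - u / T n)) j = b'
  generalize branch (-1) θ₁ θ₂ (k - u / T n) (φ (k - u / T n)) j = b''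
  linear_combination (-(starRingEnd ℂ bp * b' * Complex.exp (p n * Complex.I))
    - starRingEnd ℂ bm * b'' * Complex.exp (-(p n * Complex.I))) * e5

/-- The limit of the characteristic function in momentum space along the double steps. -/
theorem tendsto_integral_evolve {θ₁ θ₂ : ℝ} (h₁ : Real.cos θ₁ ≠ 0) (h₂ : Real.cos θ₂ ≠ 0)
    {φ : ℝ → Fin 2 → ℂ} (hφ : Continuous φ) {C : ℝ} (hC0 : 0 ≤ C)
    (hC : ∀ k, ‖φ k 0‖ ^ 2 + ‖φ k 1‖ ^ 2 ≤ C ^ 2) {T : ℕ → ℝ}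
    (hT : Tendsto T atTop atTop) (hr : Tendsto (fun n : ℕ => (n : ℝ) / T n) atTop (𝓝 (1 / 2)))
    (u : ℝ) (j : Fin 2) :
    Tendsto (fun n : ℕ => ∫ k in (-Real.pi)..Real.pi, starRingEnd ℂ (evolve θ₁ θ₂ n k (φ k) j)
        * evolve θ₁ θ₂ n (k - u / T n) (φ (k - u / T n)) j) atTop
      (𝓝 (∫ k in (-Real.pi)..Real.pi, stationary θ₁ θ₂ u φ j k)) := by
  have hae : ∀ᵐ k : ℝ, sinQuasi θ₁ θ₂ k ≠ 0 :=
    ae_sin_two_mul_ne_zero.mono fun k hk => (sinQuasi_pos h₁ h₂ hk).ne'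
  have hE : ∀ n k, ‖evolve θ₁ θ₂ n k (φ k) j‖ ≤ C := by
    intro n k
    refine (abs_le_of_sq_le_sq' ?_ hC0).2
    have h := norm_sq_evolve θ₁ θ₂ n k (φ k)
    have h3 := hC k
    fin_cases j <;> simp <;>
      nlinarith [sq_nonneg ‖evolve θ₁ θ₂ n k (φ k) 0‖, sq_nonneg ‖evolve θ₁ θ₂ n k (φ k) 1‖]
  have hX : ∀ (σ : ℝ), |σ| = 1 → ∀ a b : ℝ,
      IntervalIntegrable (crossTerm σ θ₁ θ₂ u φ j) volume a b := fun σ hσ a b =>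
    intervalIntegrable_of_ae_bound (measurable_crossTerm σ θ₁ θ₂ u hφ j)
      (hae.mono fun k hk => norm_crossTerm_le hk hσ (hC k) hC0 j) a b
  have hD : IntervalIntegrable (stationary θ₁ θ₂ u φ j) volume (-Real.pi) Real.pi :=
    intervalIntegrable_of_ae_bound (measurable_stationary θ₁ θ₂ u hφ j)
      (hae.mono fun k hk => norm_stationary_le hk (hC k) hC0 j) _ _
  have hωc := continuous_quasiEnergy θ₁ θ₂
  have hXe : ∀ (σ : ℝ), |σ| = 1 → ∀ w : ℝ, IntervalIntegrable (fun k =>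
      Complex.exp (w * quasiEnergy θ₁ θ₂ k * Complex.I) * crossTerm σ θ₁ θ₂ u φ j k)
      volume (-Real.pi) Real.pi := fun σ hσ w =>
    (hX σ hσ _ _).continuousOn_mul (by fun_prop)
  have hF : ∀ n : ℕ, Continuous fun k => starRingEnd ℂ (evolve θ₁ θ₂ n k (φ k) j)
      * evolve θ₁ θ₂ n (k - u / T n) (φ (k - u / T n)) j := by
    intro n
    have h1 := continuous_evolve θ₁ θ₂ n hφ
    have h2 : Continuous fun k => evolve θ₁ θ₂ n k (φ k) j := by fun_prop
    have h3 : Continuous fun k => evolve θ₁ θ₂ n (k - u / T n) (φ (k - u / T n)) j :=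
      h2.comp (continuous_id.sub continuous_const)
    exact (Complex.continuous_conj.comp h2).mul h3
  have hnat : Tendsto (fun n : ℕ => (2 * n : ℝ)) atTop atTop :=
    tendsto_natCast_atTop_atTop.const_mul_atTop two_pos
  have hc1 : Tendsto (fun n : ℕ => (2 * n : ℝ)) atTop (cocompact ℝ) := by
    exact hnat.mono_right atTop_le_cocompact
  have hc2 : Tendsto (fun n : ℕ => (-(2 * n) : ℝ)) atTop (cocompact ℝ) := by
    exact (tendsto_neg_atTop_atBot.comp hnat).mono_right atBot_le_cocompact
  have r1 := (tendsto_integral_exp_quasiEnergy h₁ h₂ (hX 1 (by simp))).comp hc1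
  have r2 := (tendsto_integral_exp_quasiEnergy h₁ h₂ (hX (-1) (by simp))).comp hc2
  simp only [Function.comp_def] at r1 r2
  have hdct : Tendsto (fun n : ℕ => ∫ k in (-Real.pi)..Real.pi,
      (starRingEnd ℂ (evolve θ₁ θ₂ n k (φ k) j)
        * evolve θ₁ θ₂ n (k - u / T n) (φ (k - u / T n)) j
      - (stationary θ₁ θ₂ u φ j k
        + Complex.exp ((2 * n : ℝ) * quasiEnergy θ₁ θ₂ k * Complex.I)
          * crossTerm 1 θ₁ θ₂ u φ j k
        + Complex.exp ((-(2 * n) : ℝ) * quasiEnergy θ₁ θ₂ k * Complex.I)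
          * crossTerm (-1) θ₁ θ₂ u φ j k))) atTop
      (𝓝 (∫ _ in (-Real.pi)..Real.pi, (0 : ℂ))) := by
    -- By unitarity each amplitude is at most `C`, whence `C * C`. Of the four terms `(2 * C) * (2 *
    -- C)`, two bound `stationary` and one bounds each cross term.
    refine intervalIntegral.tendsto_integral_filter_of_dominated_convergence
      (fun _ => C * C + ((2 * C) * (2 * C) + (2 * C) * (2 * C) + (2 * C) * (2 * C)
        + (2 * C) * (2 * C))) ?_ ?_ intervalIntegrable_const ?_
    · refine Eventually.of_forall fun n => Measurable.aestronglyMeasurable ?_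
      have m1 := (hF n).measurable
      have m2 := measurable_stationary θ₁ θ₂ u hφ j
      have m3 := measurable_crossTerm 1 θ₁ θ₂ u hφ j
      have m4 := measurable_crossTerm (-1) θ₁ θ₂ u hφ j
      have m5 := hωc.measurable
      refine m1.sub ((m2.add (Measurable.mul ?_ m3)).add (Measurable.mul ?_ m4)) <;> fun_prop
    · refine Eventually.of_forall fun n => hae.mono fun k hk _ => ?_
      refine (norm_sub_le _ _).trans (add_le_add ?_ ?_)
      · rw [norm_mul, RCLike.norm_conj]
        exact mul_le_mul (hE n _) (hE n _) (norm_nonneg _) hC0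
      · refine (norm_add_le _ _).trans (add_le_add ((norm_add_le _ _).trans (add_le_add
          (norm_stationary_le hk (hC k) hC0 j) ?_)) ?_) <;>
        · rw [norm_mul, norm_exp_ofReal_mul_ofReal_mul_I, one_mul]
          exact norm_crossTerm_le hk (by simp) (hC k) hC0 j
    · exact ae_sin_two_mul_ne_zero.mono fun k hk _ =>
        tendsto_integrand_sub h₁ h₂ hφ hT hr u j hk
  simp only [intervalIntegral.integral_zero] at hdct
  have hsum := ((hdct.add r1).add r2).add_const
    (∫ k in (-Real.pi)..Real.pi, stationary θ₁ θ₂ u φ j k)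
  simp only [zero_add] at hsum
  refine hsum.congr fun n => ?_
  rw [intervalIntegral.integral_sub ((hF n).intervalIntegrable _ _)
    ((hD.add (hXe 1 (by simp) _)).add (hXe (-1) (by simp) _)),
    intervalIntegral.integral_add (hD.add (hXe 1 (by simp) _)) (hXe (-1) (by simp) _),
    intervalIntegral.integral_add hD (hXe 1 (by simp) _)]
  ring

/-! ### The direction of a uniform point of the circle seen from an inner point -/

/-- Write `e^{ix} = r + ρe^{ip}`. Comparing imaginary parts after multiplying by `e^{-ip}` gives
`sin(x - p) = -r sin p`, the law of sines, and the real parts give `ρ = √(1 - r² sin² p) - r cos p`,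
positive for `|r| < 1`. The left side is `sin x / ρ`. -/
theorem sin_div_sqrt_angle {r : ℝ} (hr : |r| < 1) (p : ℝ) :
    Real.sin (p - Real.arcsin (r * Real.sin p))
      / √(1 + r ^ 2 - 2 * r * Real.cos (p - Real.arcsin (r * Real.sin p))) = Real.sin p := by
  have hr2 : r ^ 2 < 1 := (sq_lt_one_iff_abs_lt_one r).2 hr
  have hsc := Real.sin_sq_add_cos_sq p
  have hb : |r * Real.sin p| ≤ 1 := by
    rw [abs_mul]
    exact mul_le_one₀ hr.le (abs_nonneg _) (Real.abs_sin_le_one p)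
  rw [Real.sin_sub, Real.cos_sub, Real.sin_arcsin (abs_le.1 hb).1 (abs_le.1 hb).2,
    Real.cos_arcsin]
  set q := √(1 - (r * Real.sin p) ^ 2) with hq
  have hq2 : q ^ 2 = 1 - (r * Real.sin p) ^ 2 :=
    Real.sq_sqrt (by nlinarith [sq_abs (r * Real.sin p), abs_nonneg (r * Real.sin p)])
  have hpos : 0 < q - r * Real.cos p := by
    have h1 : (r * Real.cos p) ^ 2 < q ^ 2 := by rw [hq2]; nlinarith
    linarith [abs_lt_of_sq_lt_sq' h1 (Real.sqrt_nonneg _)]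
  have h2 : 1 + r ^ 2 - 2 * r * (Real.cos p * q + Real.sin p * (r * Real.sin p))
      = (q - r * Real.cos p) ^ 2 := by
    linear_combination -hq2 - r ^ 2 * hsc
  rw [h2, Real.sqrt_sq hpos.le, div_eq_iff hpos.ne']
  ring

/-- Substitute `x = p - arcsin(r sin p)`, which fixes `±π`. The Jacobian is `1` minus `cos p` times
a function of `sin p`, and the correction integrates to zero over a full period. -/
theorem integral_sin_div_sqrt_of_lt {r : ℝ} (hr : |r| < 1) {G : ℝ → ℂ} (hG : Continuous G) :
    ∫ x in (-Real.pi)..Real.pi, G (Real.sin x / √(1 + r ^ 2 - 2 * r * Real.cos x))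
      = ∫ p in (-Real.pi)..Real.pi, G (Real.sin p) := by
  have hr2 : r ^ 2 < 1 := (sq_lt_one_iff_abs_lt_one r).2 hr
  have hlt : ∀ y : ℝ, |y| ≤ 1 → 0 < 1 - (r * y) ^ 2 := by
    intro y hy
    have : y ^ 2 ≤ 1 := (sq_le_one_iff_abs_le_one y).2 hy
    nlinarith [sq_nonneg r, sq_nonneg y]
  have hR : ∀ x : ℝ, 0 < 1 + r ^ 2 - 2 * r * Real.cos x := by
    intro x
    have h := abs_lt.1 hr
    have := Real.sin_sq_add_cos_sq x
    nlinarith [sq_nonneg (r - Real.cos x), sq_nonneg (Real.sin x), sq_nonneg (r * Real.sin x),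
      sq_nonneg (1 - r * Real.cos x)]
  have hq0 : ∀ p : ℝ, √(1 - (r * Real.sin p) ^ 2) ≠ 0 := fun p =>
    (Real.sqrt_pos.2 (hlt _ (Real.abs_sin_le_one p))).ne'
  set f : ℝ → ℝ := fun p => p - Real.arcsin (r * Real.sin p) with hf
  set f' : ℝ → ℝ := fun p => 1 - 1 / √(1 - (r * Real.sin p) ^ 2) * (r * Real.cos p) with hf'
  have hderiv : ∀ p, HasDerivAt f (f' p) p := by
    intro p
    have h1 := hlt _ (Real.abs_sin_le_one p)
    have h2 : HasDerivAt (fun p => r * Real.sin p) (r * Real.cos p) p :=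
      (Real.hasDerivAt_sin p).const_mul r
    refine (hasDerivAt_id p).sub (HasDerivAt.comp p (Real.hasDerivAt_arcsin ?_ ?_) h2)
    · intro h; rw [h] at h1; norm_num at h1
    · intro h; rw [h] at h1; norm_num at h1
  have hf'c : Continuous f' := by
    simp only [hf']
    exact continuous_const.sub ((continuous_const.div (by fun_prop) hq0).mul (by fun_prop))
  have hg : Continuous fun x => G (Real.sin x / √(1 + r ^ 2 - 2 * r * Real.cos x)) :=
    hG.comp (Real.continuous_sin.div (by fun_prop) fun x => (Real.sqrt_pos.2 (hR x)).ne')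
  have hsub := intervalIntegral.integral_deriv_smul_comp (a := -Real.pi) (b := Real.pi)
    (fun p _ => hderiv p) hf'c.continuousOn hg
  have ha : f (-Real.pi) = -Real.pi := by simp [hf]
  have hb : f Real.pi = Real.pi := by simp [hf]
  rw [ha, hb] at hsub
  rw [← hsub]
  -- In the variable `y = sin p` both limits of integration are `0`.
  have hz : ∫ p in (-Real.pi)..Real.pi, Real.cos p •
      ((fun y : ℝ => ((r / √(1 - (r * y) ^ 2) : ℝ)) • G y) ∘ Real.sin) p = 0 := by
    rw [intervalIntegral.integral_deriv_smul_comp'' Real.continuous_sin.continuousOn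
      (fun p _ => (Real.hasDerivAt_sin p).hasDerivWithinAt) Real.continuous_cos.continuousOn]
    · simp
    · refine ContinuousOn.smul (f := fun y : ℝ => r / √(1 - (r * y) ^ 2))
        (continuousOn_const.div (Continuous.continuousOn (by fun_prop)) ?_) hG.continuousOn
      rintro y ⟨p, _, rfl⟩
      exact hq0 p
  have hi1 : Continuous fun p => G (Real.sin p) := by fun_prop
  have hi2 : Continuous fun p => Real.cos p •
      ((fun y : ℝ => ((r / √(1 - (r * y) ^ 2) : ℝ)) • G y) ∘ Real.sin) p := by
    exact Real.continuous_cos.smul ((continuous_const.div (by fun_prop) hq0).smul hi1)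
  rw [← sub_zero (∫ p in (-Real.pi)..Real.pi, G (Real.sin p)), ← hz,
    ← intervalIntegral.integral_sub (hi1.intervalIntegrable _ _) (hi2.intervalIntegrable _ _)]
  refine intervalIntegral.integral_congr fun p _ => ?_
  simp only [Function.comp, hf, sin_div_sqrt_angle hr, hf', smul_smul, sub_smul, one_smul]
  congr 2
  ring

theorem integral_comp_sin_eq_two_mul {G : ℝ → ℂ} (hG : Continuous G) :
    ∫ p in (-Real.pi)..Real.pi, G (Real.sin p)
      = 2 * ∫ p in (-(Real.pi / 2))..(Real.pi / 2), G (Real.sin p) := by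
  have hper : Function.Periodic (fun p => G (Real.sin p)) (2 * Real.pi) := fun p => by simp
  have hc : ∀ a b : ℝ, IntervalIntegrable (fun p => G (Real.sin p)) volume a b := fun a b =>
    (hG.comp Real.continuous_sin).intervalIntegrable a b
  have h1 := hper.intervalIntegral_add_eq (-Real.pi) (-(Real.pi / 2))
  rw [show -Real.pi + 2 * Real.pi = Real.pi by ring] at h1
  rw [h1, ← intervalIntegral.integral_add_adjacent_intervals (hc _ (Real.pi / 2)) (hc _ _)]
  have h2 := intervalIntegral.integral_comp_sub_left (a := -(Real.pi / 2)) (b := Real.pi / 2)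
    (fun p => G (Real.sin p)) Real.pi
  simp only [Real.sin_pi_sub] at h2
  rw [show Real.pi - Real.pi / 2 = Real.pi / 2 by ring,
    show Real.pi - -(Real.pi / 2) = -(Real.pi / 2) + 2 * Real.pi by ring] at h2
  rw [← h2]
  ring

/-- The degenerate case, in which the observer lies on the circle. By half-angle formulas the
quotient is `cos(x/2)` for `x > 0` and `-cos(x/2)` for `x < 0`. Written as sines, the two halves
cover the angles from `-π/2` to `π/2`, and the factor `2` from `dx` matches the reflection `p ↦ π -
p`. -/
theorem integral_sin_div_sqrt_one {G : ℝ → ℂ} (hG : Continuous G) :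
    ∫ x in (-Real.pi)..Real.pi, G (Real.sin x / √(1 + 1 ^ 2 - 2 * 1 * Real.cos x))
      = ∫ p in (-Real.pi)..Real.pi, G (Real.sin p) := by
  have hpi := Real.pi_pos
  have hsq : ∀ x : ℝ, 1 + 1 ^ 2 - 2 * 1 * Real.cos x = (2 * Real.sin (x / 2)) ^ 2 := by
    intro x
    have h := Real.cos_two_mul (x / 2)
    rw [mul_div_cancel₀ x two_ne_zero] at h
    rw [h]
    linear_combination -4 * Real.sin_sq_add_cos_sq (x / 2)
  have hsin : ∀ x : ℝ, Real.sin x = 2 * Real.sin (x / 2) * Real.cos (x / 2) := by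
    intro x
    rw [← Real.sin_two_mul, mul_div_cancel₀ x two_ne_zero]
  have h1 : (fun x => G (Real.sin x / √(1 + 1 ^ 2 - 2 * 1 * Real.cos x)))
      =ᵐ[volume.restrict (Set.uIoc 0 Real.pi)]
      fun x => G (Real.sin (Real.pi / 2 - x / 2)) := by
    refine (ae_restrict_iff' measurableSet_uIoc).2 (Eventually.of_forall fun x hx => ?_)
    rw [Set.uIoc_of_le hpi.le] at hx
    have h : 0 < Real.sin (x / 2) :=
      Real.sin_pos_of_pos_of_lt_pi (by linarith [hx.1]) (by linarith [hx.2])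
    beta_reduce
    rw [hsq, Real.sqrt_sq (by positivity), hsin x, Real.sin_pi_div_two_sub,
      mul_div_cancel_left₀ _ (by positivity)]
  have h2 : (fun x => G (Real.sin x / √(1 + 1 ^ 2 - 2 * 1 * Real.cos x)))
      =ᵐ[volume.restrict (Set.uIoc (-Real.pi) 0)]
      fun x => G (Real.sin (-(Real.pi / 2) - x / 2)) := by
    refine (ae_restrict_iff' measurableSet_uIoc).2 ?_
    have h0 : ∀ᵐ x : ℝ, x ≠ 0 := by simp [ae_iff]
    filter_upwards [h0] with x hx0 hx
    rw [Set.uIoc_of_le (by linarith)] at hx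
    have h : Real.sin (x / 2) < 0 :=
      Real.sin_neg_of_neg_of_neg_pi_lt (by linarith [lt_of_le_of_ne hx.2 hx0])
        (by linarith [hx.1])
    have e : -(Real.pi / 2) - x / 2 = -(x / 2 + Real.pi / 2) := by ring
    rw [hsq, Real.sqrt_sq_eq_abs, abs_of_neg (by linarith), hsin x, div_neg,
      mul_div_cancel_left₀ _ (by linarith), e, Real.sin_neg, Real.sin_add_pi_div_two]
  have hc : ∀ a b : ℝ, IntervalIntegrable (fun p => G (Real.sin p)) volume a b := fun a b =>
    (hG.comp Real.continuous_sin).intervalIntegrable a b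
  have i1 : IntervalIntegrable (fun x => G (Real.sin x / √(1 + 1 ^ 2 - 2 * 1 * Real.cos x)))
      volume 0 Real.pi := by
    refine IntervalIntegrable.congr_ae ?_ h1.symm
    exact Continuous.intervalIntegrable (by fun_prop) _ _
  have i2 : IntervalIntegrable (fun x => G (Real.sin x / √(1 + 1 ^ 2 - 2 * 1 * Real.cos x)))
      volume (-Real.pi) 0 := by
    refine IntervalIntegrable.congr_ae ?_ h2.symm
    exact Continuous.intervalIntegrable (by fun_prop) _ _
  rw [← intervalIntegral.integral_add_adjacent_intervals i2 i1,
    intervalIntegral.integral_congr_ae_restrict h1,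
    intervalIntegral.integral_congr_ae_restrict h2,
    intervalIntegral.integral_comp_sub_div (fun p => G (Real.sin p)) two_ne_zero,
    intervalIntegral.integral_comp_sub_div (fun p => G (Real.sin p)) two_ne_zero,
    integral_comp_sin_eq_two_mul hG]
  rw [show -(Real.pi / 2) - 0 / 2 = -(Real.pi / 2) by ring,
    show -(Real.pi / 2) - -Real.pi / 2 = 0 by ring,
    show Real.pi / 2 - Real.pi / 2 = 0 by ring,
    show Real.pi / 2 - 0 / 2 = Real.pi / 2 by ring, ← smul_add,
    intervalIntegral.integral_add_adjacent_intervals (hc _ _) (hc _ _)]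
  simp [Complex.real_smul]

theorem integral_comp_neg_sin (G : ℝ → ℂ) :
    ∫ p in (-Real.pi)..Real.pi, G (-Real.sin p) = ∫ p in (-Real.pi)..Real.pi, G (Real.sin p) := by
  have h := intervalIntegral.integral_comp_neg (a := -Real.pi) (b := Real.pi)
    (fun p => G (Real.sin p))
  simpa using h

/-- The direction of `e^{ix} - r`, for `x` uniform on the circle and `|r| ≤ 1`, has the law of
the sine of a uniform angle. -/
theorem integral_sin_div_sqrt {r : ℝ} (hr : |r| ≤ 1) {G : ℝ → ℂ} (hG : Continuous G) :
    ∫ x in (-Real.pi)..Real.pi, G (Real.sin x / √(1 + r ^ 2 - 2 * r * Real.cos x))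
      = ∫ p in (-Real.pi)..Real.pi, G (Real.sin p) := by
  rcases hr.lt_or_eq with h | h
  · exact integral_sin_div_sqrt_of_lt h hG
  rcases (abs_eq zero_le_one).1 h with rfl | rfl
  · exact integral_sin_div_sqrt_one hG
  -- For `r = -1`, translating `x` by `π` flips both sine and cosine; this leads back to `r = 1`
  -- with the argument of `G` negated.
  · have h1 := integral_sin_div_sqrt_one (G := fun x => G (-x)) (by fun_prop)
    rw [integral_comp_neg_sin] at h1
    rw [← h1]
    set φ : ℝ → ℂ := fun x => G (-(Real.sin x / √(1 + 1 ^ 2 - 2 * 1 * Real.cos x))) with hφ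
    have hper : Function.Periodic φ (2 * Real.pi) := fun p => by simp [hφ]
    have h2 := hper.intervalIntegral_add_eq (-Real.pi) 0
    rw [show -Real.pi + 2 * Real.pi = Real.pi by ring] at h2
    rw [h2]
    have h3 := intervalIntegral.integral_comp_add_right (a := -Real.pi) (b := Real.pi) φ Real.pi
    rw [neg_add_cancel, ← two_mul] at h3
    rw [zero_add, ← h3]
    refine intervalIntegral.integral_congr fun x _ => ?_
    simp only [hφ, Real.sin_add_pi, Real.cos_add_pi]
    ring_nf

/-! ### The law of the velocity -/

/-- The group velocity of the walk with the constant coin of determinant `-1` and diagonal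
entry `c`. -/
noncomputable def arcVelocity (c p : ℝ) : ℝ := c * Real.sin p / √(1 - c ^ 2 * Real.cos p ^ 2)

theorem one_sub_cos_sq_pos {c : ℝ} (hc : |c| < 1) (p : ℝ) : 0 < 1 - c ^ 2 * Real.cos p ^ 2 := by
  have h1 : c ^ 2 < 1 := (sq_lt_one_iff_abs_lt_one c).2 hc
  nlinarith [Real.sin_sq_add_cos_sq p, sq_nonneg (Real.sin p), sq_nonneg (Real.cos p)]

theorem integral_comp_two_mul {g : ℝ → ℂ} (hg : Function.Periodic g (2 * Real.pi))
    (hi : ∀ a b : ℝ, IntervalIntegrable g volume a b) :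
    ∫ k in (-Real.pi)..Real.pi, g (2 * k) = ∫ x in (-Real.pi)..Real.pi, g x := by
  rw [intervalIntegral.integral_comp_mul_left g two_ne_zero,
    ← intervalIntegral.integral_add_adjacent_intervals (hi _ 0) (hi _ _)]
  have h1 := hg.intervalIntegral_add_eq (-Real.pi) (2 * -Real.pi)
  have h2 := hg.intervalIntegral_add_eq (-Real.pi) 0
  rw [show -Real.pi + 2 * Real.pi = Real.pi by ring] at h1 h2
  rw [show 2 * -Real.pi + 2 * Real.pi = 0 by ring] at h1
  rw [zero_add] at h2
  rw [← h1, ← h2, ← two_smul ℝ, smul_smul]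
  norm_num

/-- With `r = c₁s₂/(c₂s₁)` and `R = |e^{2ik} - r|²` one has `sin² ω = c₂²(c₁² sin² 2k + s₁²R)`.
Dividing by `c₂²R` makes `v` a function of `sin 2k / √R` in which the second coin appears only
through `r` and a sign. -/
theorem velocity_eq {θ₁ θ₂ k : ℝ} (hc₁ : Real.cos θ₁ ≠ 0) (hc₂ : Real.cos θ₂ ≠ 0)
    (hs₁ : Real.sin θ₁ ≠ 0) (hk : Real.sin (2 * k) ≠ 0) :
    velocity θ₁ θ₂ k = |Real.cos θ₁| * (SignType.sign (Real.cos θ₁ * Real.cos θ₂)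
        * (Real.sin (2 * k) / √(1 + (Real.cos θ₁ * Real.sin θ₂ / (Real.cos θ₂ * Real.sin θ₁)) ^ 2
          - 2 * (Real.cos θ₁ * Real.sin θ₂ / (Real.cos θ₂ * Real.sin θ₁)) * Real.cos (2 * k))))
      / √(1 - |Real.cos θ₁| ^ 2 + |Real.cos θ₁| ^ 2 * (SignType.sign (Real.cos θ₁ * Real.cos θ₂)
        * (Real.sin (2 * k) / √(1 + (Real.cos θ₁ * Real.sin θ₂ / (Real.cos θ₂ * Real.sin θ₁)) ^ 2
          - 2 * (Real.cos θ₁ * Real.sin θ₂ / (Real.cos θ₂ * Real.sin θ₁)) * Real.cos (2 * k))))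
            ^ 2) := by
  set r := Real.cos θ₁ * Real.sin θ₂ / (Real.cos θ₂ * Real.sin θ₁) with hr
  set R := 1 + r ^ 2 - 2 * r * Real.cos (2 * k) with hR
  have hR0 : 0 < R := by
    have h : R = (Real.cos (2 * k) - r) ^ 2 + Real.sin (2 * k) ^ 2 := by
      rw [hR]; linear_combination -Real.sin_sq_add_cos_sq (2 * k)
    rw [h]; positivity
  set ε : ℝ := (SignType.sign (Real.cos θ₁ * Real.cos θ₂) : ℝ) with hε
  have hε1 : ε * |Real.cos θ₁ * Real.cos θ₂| = Real.cos θ₁ * Real.cos θ₂ := sign_mul_abs _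
  have hε2 : ε ^ 2 = 1 := by
    have h0 := mul_ne_zero hc₁ hc₂
    have h1 := congrArg (· ^ 2) hε1
    simp only [mul_pow, sq_abs] at h1
    have h2 : (Real.cos θ₁ ^ 2 * Real.cos θ₂ ^ 2) ≠ 0 := by positivity
    exact mul_right_cancel₀ h2 (by rw [h1, one_mul])
  have hq : 0 < √R := Real.sqrt_pos.2 hR0
  have hD : offDiagSq θ₁ θ₂ k = (Real.cos θ₂ * Real.sin θ₁) ^ 2 * R := by
    rw [offDiagSq, hR, hr]
    field_simp
    ring
  have hsin1 : 1 - |Real.cos θ₁| ^ 2 = Real.sin θ₁ ^ 2 := by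
    rw [sq_abs]; linear_combination -Real.sin_sq_add_cos_sq θ₁
  have hc2 : 0 < |Real.cos θ₂| := abs_pos.2 hc₂
  have hden : sinQuasi θ₁ θ₂ k = |Real.cos θ₂| * √R *
      √(Real.sin θ₁ ^ 2 + |Real.cos θ₁| ^ 2 * (ε * (Real.sin (2 * k) / √R)) ^ 2) := by
    have h : (Real.cos θ₁ * Real.cos θ₂ * Real.sin (2 * k)) ^ 2
        + (Real.cos θ₂ * Real.sin θ₁) ^ 2 * R = (|Real.cos θ₂| * √R) ^ 2
          * (Real.sin θ₁ ^ 2 + |Real.cos θ₁| ^ 2 * (ε * (Real.sin (2 * k) / √R)) ^ 2) := by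
      rw [mul_pow |Real.cos θ₂|, sq_abs, sq_abs, mul_pow ε, hε2, div_pow, Real.sq_sqrt hR0.le]
      field_simp
      ring
    rw [sinQuasi, one_sub_halfTrace_sq, hD, h, Real.sqrt_mul (sq_nonneg _),
      Real.sqrt_sq (by positivity)]
  rw [hsin1, velocity, hden, ← hε1, abs_mul]
  field_simp

theorem velocity_comm (θ₁ θ₂ k : ℝ) : velocity θ₁ θ₂ k = velocity θ₂ θ₁ k := by
  simp only [velocity, sinQuasi, halfTrace, mul_comm (Real.cos θ₁), mul_comm (Real.sin θ₁)]

theorem abs_sin_div_sqrt_le (r x : ℝ) :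
    |Real.sin x / √(1 + r ^ 2 - 2 * r * Real.cos x)| ≤ 1 := by
  have h : Real.sin x ^ 2 ≤ 1 + r ^ 2 - 2 * r * Real.cos x := by
    nlinarith [sq_nonneg (Real.cos x - r), Real.sin_sq_add_cos_sq x]
  rw [abs_div, abs_of_nonneg (Real.sqrt_nonneg _)]
  exact div_le_one_of_le₀ (Real.abs_le_sqrt h) (Real.sqrt_nonneg _)

/-- If the coin `θ₁` has the smaller diagonal entry, the velocity has the same law as for the walk
with the constant coin `θ₁`. -/
theorem integral_comp_velocity_of_le {θ₁ θ₂ : ℝ} (hc₁ : Real.cos θ₁ ≠ 0) (hc₂ : Real.cos θ₂ ≠ 0)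
    (hs₁ : Real.sin θ₁ ≠ 0) (hle : |Real.cos θ₁| ≤ |Real.cos θ₂|)
    {F : ℝ → ℂ} (hF : Continuous F) :
    ∫ k in (-Real.pi)..Real.pi, F (velocity θ₁ θ₂ k)
      = ∫ p in (-Real.pi)..Real.pi, F (arcVelocity |Real.cos θ₁| p) := by
  set r := Real.cos θ₁ * Real.sin θ₂ / (Real.cos θ₂ * Real.sin θ₁) with hr
  set ε : ℝ := (SignType.sign (Real.cos θ₁ * Real.cos θ₂) : ℝ) with hε
  set c := |Real.cos θ₁| with hc
  have hc1 : c ^ 2 < 1 := by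
    rw [hc, sq_abs]
    have := Real.sin_sq_add_cos_sq θ₁
    have : 0 < Real.sin θ₁ ^ 2 := by positivity
    linarith
  -- The only use of the ordering of the coins: `|c₁| ≤ |c₂|` forces `|s₂| ≤ |s₁|`.
  have hr1 : |r| ≤ 1 := by
    rw [hr, abs_div, abs_mul, abs_mul]
    refine div_le_one_of_le₀ (mul_le_mul hle ?_ (abs_nonneg _) (abs_nonneg _)) (by positivity)
    have h := sq_le_sq.2 hle
    exact sq_le_sq.1 (by linarith [Real.sin_sq_add_cos_sq θ₁, Real.sin_sq_add_cos_sq θ₂])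
  have hε1 : ε = 1 ∨ ε = -1 := by
    rcases lt_or_gt_of_ne (mul_ne_zero hc₁ hc₂) with h | h
    · right; simp [hε, sign_neg h]
    · left; simp [hε, sign_pos h]
  set G : ℝ → ℂ := fun x => F (c * x / √(1 - c ^ 2 + c ^ 2 * x ^ 2)) with hG
  have hGc : Continuous G := by
    refine hF.comp (Continuous.div (by fun_prop) (by fun_prop) fun x => ?_)
    refine (Real.sqrt_pos.2 ?_).ne'
    nlinarith [sq_nonneg (c * x)]
  set g : ℝ → ℂ := fun x => G (ε * (Real.sin x / √(1 + r ^ 2 - 2 * r * Real.cos x))) with hg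
  -- Measurability and boundedness replace continuity, because for `|r| = 1` the quotient jumps
  -- where the root vanishes.
  have hgm : Measurable g := hGc.measurable.comp (by fun_prop)
  obtain ⟨M, hM⟩ := (isCompact_Icc (a := (-1 : ℝ)) (b := 1)).exists_bound_of_continuousOn
    hGc.continuousOn
  have hgb : ∀ x, ‖g x‖ ≤ M := by
    intro x
    refine hM _ (abs_le.1 ?_)
    have h : |ε| = 1 := by rcases hε1 with h | h <;> simp [h]
    rw [abs_mul, h, one_mul]
    exact abs_sin_div_sqrt_le r x
  have hgi := intervalIntegrable_of_ae_bound hgm (Eventually.of_forall hgb)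
  have hgp : Function.Periodic g (2 * Real.pi) := fun x => by simp [hg]
  calc ∫ k in (-Real.pi)..Real.pi, F (velocity θ₁ θ₂ k)
      = ∫ k in (-Real.pi)..Real.pi, g (2 * k) := by
        refine intervalIntegral.integral_congr_ae (ae_sin_two_mul_ne_zero.mono fun k hk _ => ?_)
        rw [velocity_eq hc₁ hc₂ hs₁ hk]
    _ = ∫ x in (-Real.pi)..Real.pi, g x := integral_comp_two_mul hgp hgi
    _ = ∫ p in (-Real.pi)..Real.pi, G (ε * Real.sin p) :=
        integral_sin_div_sqrt hr1 (G := fun x => G (ε * x)) (by fun_prop)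
    _ = ∫ p in (-Real.pi)..Real.pi, G (Real.sin p) := by
        rcases hε1 with h | h
        · simp [h]
        · simp only [h, neg_mul, one_mul]
          exact integral_comp_neg_sin G
    _ = ∫ p in (-Real.pi)..Real.pi, F (arcVelocity c p) := by
        refine intervalIntegral.integral_congr fun p _ => ?_
        simp only [hG, arcVelocity]
        congr 3
        linear_combination c ^ 2 * Real.sin_sq_add_cos_sq p

theorem hasDerivAt_arcVelocity {c : ℝ} (hc : |c| < 1) (p : ℝ) :
    HasDerivAt (arcVelocity c)
      (c * Real.cos p * (1 - c ^ 2) / √(1 - c ^ 2 * Real.cos p ^ 2) ^ 3) p := by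
  have hD := one_sub_cos_sq_pos hc p
  have h1 : HasDerivAt (fun p => 1 - c ^ 2 * Real.cos p ^ 2)
      (-(c ^ 2 * (2 * Real.cos p * (-Real.sin p)))) p := by
    simpa using (((Real.hasDerivAt_cos p).pow 2).const_mul (c ^ 2)).const_sub 1
  have h2 := ((Real.hasDerivAt_sin p).const_mul c).div (h1.sqrt hD.ne') (Real.sqrt_pos.2 hD).ne'
  refine HasDerivAt.congr_deriv (f := arcVelocity c) h2 ?_
  have hq : 0 < √(1 - c ^ 2 * Real.cos p ^ 2) := Real.sqrt_pos.2 hD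
  have hq2 : √(1 - c ^ 2 * Real.cos p ^ 2) ^ 2 = 1 - c ^ 2 * Real.cos p ^ 2 :=
    Real.sq_sqrt hD.le
  set q := √(1 - c ^ 2 * Real.cos p ^ 2)
  field_simp
  rw [hq2]
  linear_combination -c ^ 3 * Real.cos p * Real.sin_sq_add_cos_sq p

theorem one_sub_arcVelocity_sq {c : ℝ} (hc : |c| < 1) (p : ℝ) :
    1 - arcVelocity c p ^ 2 = (1 - c ^ 2) / √(1 - c ^ 2 * Real.cos p ^ 2) ^ 2 := by
  have hD := one_sub_cos_sq_pos hc p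
  rw [arcVelocity, div_pow, Real.sq_sqrt hD.le, eq_div_iff hD.ne', sub_mul,
    div_mul_cancel₀ _ hD.ne']
  linear_combination -c ^ 2 * Real.sin_sq_add_cos_sq p

theorem sq_sub_arcVelocity_sq {c : ℝ} (hc : |c| < 1) (p : ℝ) :
    c ^ 2 - arcVelocity c p ^ 2
      = c ^ 2 * Real.cos p ^ 2 * (1 - c ^ 2) / √(1 - c ^ 2 * Real.cos p ^ 2) ^ 2 := by
  have hD := one_sub_cos_sq_pos hc p
  rw [arcVelocity, div_pow, Real.sq_sqrt hD.le, eq_div_iff hD.ne', sub_mul,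
    div_mul_cancel₀ _ hD.ne']
  linear_combination -c ^ 2 * Real.sin_sq_add_cos_sq p

theorem arcVelocity_image {c : ℝ} (hc0 : 0 < c) (hc1 : c < 1) :
    arcVelocity c '' Set.Ioo (-(Real.pi / 2)) (Real.pi / 2) = Set.Ioo (-c) c := by
  have hc : |c| < 1 := by rwa [abs_of_pos hc0]
  have hs : 0 < 1 - c ^ 2 := by nlinarith
  refine Set.Subset.antisymm ?_ ?_
  · rintro _ ⟨p, hp, rfl⟩
    have h1 := sq_sub_arcVelocity_sq hc p
    have h2 := Real.cos_pos_of_mem_Ioo hp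
    have h3 := Real.sqrt_pos.2 (one_sub_cos_sq_pos hc p)
    have h4 : 0 < c ^ 2 - arcVelocity c p ^ 2 := by rw [h1]; positivity
    exact abs_lt_of_sq_lt_sq' (by linarith) hc0.le
  · have h := intermediate_value_Ioo (show -(Real.pi / 2) ≤ Real.pi / 2 by linarith [Real.pi_pos])
      (f := arcVelocity c)
      (fun p _ => (hasDerivAt_arcVelocity hc p).continuousAt.continuousWithinAt)
    have e1 : arcVelocity c (-(Real.pi / 2)) = -c := by simp [arcVelocity]
    have e2 : arcVelocity c (Real.pi / 2) = c := by simp [arcVelocity]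
    rwa [e1, e2] at h

/-- The density of `arcVelocity c` at a uniform angle, up to the factor `2 π`. -/
noncomputable def arcDensity (c y : ℝ) : ℝ := 2 * √(1 - c ^ 2) / ((1 - y ^ 2) * √(c ^ 2 - y ^ 2))

/-- The value `2` counts the angles `p` and `π - p` of a full period, which share one velocity; this
lemma uses a single monotone branch. -/
theorem abs_deriv_mul_arcDensity {c : ℝ} (hc0 : 0 < c) (hc1 : c < 1) {p : ℝ}
    (hp : p ∈ Set.Ioo (-(Real.pi / 2)) (Real.pi / 2)) :
    |c * Real.cos p * (1 - c ^ 2) / √(1 - c ^ 2 * Real.cos p ^ 2) ^ 3|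
      * arcDensity c (arcVelocity c p) = 2 := by
  have hc : |c| < 1 := by rwa [abs_of_pos hc0]
  have hs : 0 < 1 - c ^ 2 := by nlinarith
  have h2 := Real.cos_pos_of_mem_Ioo hp
  have h3 := Real.sqrt_pos.2 (one_sub_cos_sq_pos hc p)
  have hw := Real.sqrt_pos.2 hs
  have hw2 := Real.sq_sqrt hs.le
  set q := √(1 - c ^ 2 * Real.cos p ^ 2)
  set w := √(1 - c ^ 2)
  have h4 : √(c ^ 2 - arcVelocity c p ^ 2) = c * Real.cos p * w / q := by
    rw [sq_sub_arcVelocity_sq hc p, ← hw2]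
    rw [show c ^ 2 * Real.cos p ^ 2 * w ^ 2 / q ^ 2 = (c * Real.cos p * w / q) ^ 2 by ring]
    exact Real.sqrt_sq (by positivity)
  rw [abs_of_pos (by positivity), arcDensity, h4, one_sub_arcVelocity_sq hc p]
  field_simp
  change w * q ^ 2 = q ^ 2 * w
  ring

theorem arcVelocity_injOn {c : ℝ} (hc0 : 0 < c) (hc1 : c < 1) :
    Set.InjOn (arcVelocity c) (Set.Ioo (-(Real.pi / 2)) (Real.pi / 2)) := by
  have hc : |c| < 1 := by rwa [abs_of_pos hc0]
  have hs : 0 < 1 - c ^ 2 := by nlinarith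
  refine (strictMonoOn_of_deriv_pos (convex_Ioo _ _) (fun p _ =>
    (hasDerivAt_arcVelocity hc p).continuousAt.continuousWithinAt) fun p hp => ?_).injOn
  rw [interior_Ioo] at hp
  rw [(hasDerivAt_arcVelocity hc p).deriv]
  have h2 := Real.cos_pos_of_mem_Ioo hp
  have h3 := Real.sqrt_pos.2 (one_sub_cos_sq_pos hc p)
  positivity

/-- The singularities at `±c` are harmless because the density pulls back to a constant under
`arcVelocity`. -/
theorem integrableOn_arcDensity {c : ℝ} (hc0 : 0 < c) (hc1 : c < 1) :
    IntegrableOn (arcDensity c) (Set.Ioo (-c) c) := by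
  have hc : |c| < 1 := by rwa [abs_of_pos hc0]
  rw [← arcVelocity_image hc0 hc1, integrableOn_image_iff_integrableOn_abs_deriv_smul
    measurableSet_Ioo (fun p _ => (hasDerivAt_arcVelocity hc p).hasDerivWithinAt)
    (arcVelocity_injOn hc0 hc1)]
  refine (integrableOn_const (C := (2 : ℝ)) (by simp)).congr_fun (fun p hp => ?_) measurableSet_Ioo
  exact (abs_deriv_mul_arcDensity hc0 hc1 hp).symm

theorem integral_comp_arcVelocity {c : ℝ} (hc0 : 0 < c) (hc1 : c < 1) {F : ℝ → ℂ}
    (hF : Continuous F) :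
    ∫ p in (-Real.pi)..Real.pi, F (arcVelocity c p)
      = ∫ y in Set.Ioo (-c) c, arcDensity c y • F y := by
  have hc : |c| < 1 := by rwa [abs_of_pos hc0]
  have hs : 0 < 1 - c ^ 2 := by nlinarith
  set G : ℝ → ℂ := fun x => F (c * x / √(1 - c ^ 2 + c ^ 2 * x ^ 2)) with hG
  have hGc : Continuous G := by
    refine hF.comp (Continuous.div (by fun_prop) (by fun_prop) fun x => ?_)
    refine (Real.sqrt_pos.2 ?_).ne'
    nlinarith [sq_nonneg (c * x)]
  have hGF : ∀ p, F (arcVelocity c p) = G (Real.sin p) := by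
    intro p
    simp only [hG, arcVelocity]
    congr 3
    linear_combination -c ^ 2 * Real.sin_sq_add_cos_sq p
  rw [← arcVelocity_image hc0 hc1, integral_image_eq_integral_abs_deriv_smul
    measurableSet_Ioo (fun p _ => (hasDerivAt_arcVelocity hc p).hasDerivWithinAt)
    (arcVelocity_injOn hc0 hc1)]
  simp_rw [hGF]
  rw [integral_comp_sin_eq_two_mul hGc,
    intervalIntegral.integral_of_le (by linarith [Real.pi_pos]), integral_Ioc_eq_integral_Ioo,
    ← integral_const_mul]
  refine setIntegral_congr_fun measurableSet_Ioo fun p hp => ?_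
  simp only [smul_smul, abs_deriv_mul_arcDensity hc0 hc1 hp]
  simp [Complex.real_smul]

/-- The law of the velocity at a uniform momentum. -/
theorem integral_comp_velocity {θ₁ θ₂ : ℝ} (hc₁ : Real.cos θ₁ ≠ 0) (hc₂ : Real.cos θ₂ ≠ 0)
    (hs₁ : Real.sin θ₁ ≠ 0) (hs₂ : Real.sin θ₂ ≠ 0) {c : ℝ}
    (hc : c = min |Real.cos θ₁| |Real.cos θ₂|) {F : ℝ → ℂ} (hF : Continuous F) :
    ∫ k in (-Real.pi)..Real.pi, F (velocity θ₁ θ₂ k)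
      = ∫ y in Set.Ioo (-c) c, arcDensity c y • F y := by
  have hlt : ∀ θ : ℝ, Real.sin θ ≠ 0 → |Real.cos θ| < 1 := by
    intro θ h
    rw [← sq_lt_one_iff_abs_lt_one]
    have : 0 < Real.sin θ ^ 2 := by positivity
    linarith [Real.sin_sq_add_cos_sq θ]
  rcases le_total |Real.cos θ₁| |Real.cos θ₂| with h | h
  · rw [hc, min_eq_left h, integral_comp_velocity_of_le hc₁ hc₂ hs₁ h hF,
      integral_comp_arcVelocity (abs_pos.2 hc₁) (hlt _ hs₁) hF]
  · rw [hc, min_eq_right h]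
    simp_rw [velocity_comm θ₁ θ₂]
    rw [integral_comp_velocity_of_le hc₂ hc₁ hs₂ h hF,
      integral_comp_arcVelocity (abs_pos.2 hc₂) (hlt _ hs₂) hF]

/-! ### Branch weights and their dependence on the initial state -/

/-- The expectation of the axis of the two-step operator in the state `v`. -/
noncomputable def axisQuad (θ₁ θ₂ k : ℝ) (v : Fin 2 → ℂ) : ℝ :=
  velocity θ₁ θ₂ k * (‖v 0‖ ^ 2 - ‖v 1‖ ^ 2)
    + 2 * (starRingEnd ℂ (v 0) * axisOff θ₁ θ₂ k * v 1).re

/-- The sign of the inner state `j` in the diagonal of the Pauli matrix `σ_z`. -/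
def innerSign (j : Fin 2) : ℝ := ![1, -1] j

/-- For a rank-one projection `P` one has `|(Pv)_j|² = P_jj ⟨v, Pv⟩`. Here `P = (1 + σN)/2`, which
has rank one since `N` is a traceless involution. -/
theorem conj_branch_mul_branch {θ₁ θ₂ k : ℝ} (hs : sinQuasi θ₁ θ₂ k ≠ 0) {σ : ℝ}
    (hσ : σ ^ 2 = 1) (v : Fin 2 → ℂ) (j : Fin 2) :
    starRingEnd ℂ (branch σ θ₁ θ₂ k v j) * branch σ θ₁ θ₂ k v j
      = ((1 + σ * innerSign j * velocity θ₁ θ₂ k) / 4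
        * (‖v 0‖ ^ 2 + ‖v 1‖ ^ 2 + σ * axisQuad θ₁ θ₂ k v) : ℝ) := by
  rw [← Complex.normSq_eq_conj_mul_self]
  congr 1
  have h := velocity_sq_add_normSq_axisOff hs
  rw [Complex.normSq_apply] at h
  have hre : ∀ z : ℂ, (z / 2).re = z.re / 2 := fun z => by simp
  have him : ∀ z : ℂ, (z / 2).im = z.im / 2 := fun z => by simp
  rw [Complex.normSq_apply, axisQuad]
  simp only [← Complex.normSq_eq_norm_sq, Complex.normSq_apply]
  fin_cases j
  · simp only [branch, axisOp, innerSign, Fin.zero_eta, Matrix.cons_val_zero, hre, him,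
      Complex.add_re, Complex.add_im, Complex.ofReal_re, Complex.ofReal_im,
      Complex.mul_re, Complex.mul_im, Complex.conj_re, Complex.conj_im]
    linear_combination ((v 1).re ^ 2 + (v 1).im ^ 2) / 4 * (σ ^ 2 * h + hσ)
  · simp only [branch, axisOp, innerSign, Fin.mk_one, Matrix.cons_val_zero, Matrix.cons_val_one,
      hre, him, Complex.add_re, Complex.add_im, Complex.sub_re, Complex.sub_im,
      Complex.ofReal_re, Complex.ofReal_im,
      Complex.mul_re, Complex.mul_im, Complex.conj_re, Complex.conj_im]
    linear_combination ((v 0).re ^ 2 + (v 0).im ^ 2) / 4 * (σ ^ 2 * h + hσ)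

theorem sinQuasi_neg (θ₁ θ₂ k : ℝ) : sinQuasi θ₁ θ₂ (-k) = sinQuasi θ₁ θ₂ k := by
  simp [sinQuasi, halfTrace]

theorem sinQuasi_add_pi (θ₁ θ₂ k : ℝ) : sinQuasi θ₁ θ₂ (k + Real.pi) = sinQuasi θ₁ θ₂ k := by
  simp [sinQuasi, halfTrace, mul_add]

theorem velocity_neg (θ₁ θ₂ k : ℝ) : velocity θ₁ θ₂ (-k) = -velocity θ₁ θ₂ k := by
  simp [velocity, sinQuasi_neg, neg_div]

theorem velocity_add_pi (θ₁ θ₂ k : ℝ) : velocity θ₁ θ₂ (k + Real.pi) = velocity θ₁ θ₂ k := by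
  simp [velocity, sinQuasi_add_pi, mul_add]

theorem axisOff_add_pi (θ₁ θ₂ k : ℝ) : axisOff θ₁ θ₂ (k + Real.pi) = axisOff θ₁ θ₂ k := by
  apply Complex.ext <;> simp [axisOff_re, axisOff_im, sinQuasi_add_pi, mul_add]

theorem axisOff_neg (θ₁ θ₂ k : ℝ) :
    axisOff θ₁ θ₂ (-k) = -starRingEnd ℂ (axisOff θ₁ θ₂ k) := by
  apply Complex.ext <;> simp [axisOff_re, axisOff_im, sinQuasi_neg, neg_div]

/-- The part of the axis in the plane of the first coin is parallel to that coin's own reflection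
axis. This is the origin of the quotient `s₁/c₁` in the limit. -/
theorem cos_mul_axisOff_re (θ₁ θ₂ k : ℝ) : Real.cos θ₁ * (axisOff θ₁ θ₂ k).re
    = Real.sin θ₁ * velocity θ₁ θ₂ k := by
  rw [axisOff_re, velocity]; ring

theorem sinQuasi_comm (θ₁ θ₂ k : ℝ) : sinQuasi θ₁ θ₂ k = sinQuasi θ₂ θ₁ k := by
  simp only [sinQuasi, halfTrace, mul_comm (Real.cos θ₁), mul_comm (Real.sin θ₁)]

theorem axisQuad_add_pi (θ₁ θ₂ k : ℝ) (v : Fin 2 → ℂ) :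
    axisQuad θ₁ θ₂ (k + Real.pi) v = axisQuad θ₁ θ₂ k v := by
  rw [axisQuad, axisQuad, velocity_add_pi, axisOff_add_pi]

/-- The expectation of the axis is carried along by the first half of the double step. -/
theorem axisQuad_stepHat (θ₁ θ₂ k : ℝ) (v : Fin 2 → ℂ) :
    axisQuad θ₂ θ₁ k (stepHat θ₁ k v) = axisQuad θ₁ θ₂ k v := by
  -- The phase from the shift turns the off-diagonal entry for the exchanged coins into the
  -- conjugate of the original. The coin, a half-turn about an axis parallel to the real part, then
  -- undoes this conjugation, which is where `hc` enters.
  have hm : Complex.exp (-(k * Complex.I)) * Complex.exp (-(k * Complex.I)) * axisOff θ₂ θ₁ k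
      = starRingEnd ℂ (axisOff θ₁ θ₂ k) := by
    have e3 : Complex.exp (-(k * Complex.I)) * Complex.exp (-(k * Complex.I))
        * Complex.exp (2 * k * Complex.I) = 1 := by
      rw [← Complex.exp_add, ← Complex.exp_add]; ring_nf; exact Complex.exp_zero
    have e4 : Complex.exp (2 * k * -Complex.I)
        = Complex.exp (-(k * Complex.I)) * Complex.exp (-(k * Complex.I)) := by
      rw [← Complex.exp_add]; ring_nf
    rw [axisOff, axisOff, map_div₀, map_sub, map_mul, map_mul, ← Complex.exp_conj, map_mul,
      map_mul, Complex.conj_I, Complex.conj_ofReal, Complex.conj_ofReal, Complex.conj_ofReal,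
      Complex.conj_ofReal, map_ofNat, e4, sinQuasi_comm θ₂ θ₁, neg_mul, div_neg, ← neg_div,
      ← mul_div_assoc]
    congr 1
    push_cast
    linear_combination (Complex.cos θ₁ * Complex.sin θ₂) * e3
  have hc := cos_mul_axisOff_re θ₁ θ₂ k
  have hx : starRingEnd ℂ (stepHat θ₁ k v 0) * axisOff θ₂ θ₁ k * stepHat θ₁ k v 1
      = starRingEnd ℂ (Real.cos θ₁ * v 0 + Real.sin θ₁ * v 1) * starRingEnd ℂ (axisOff θ₁ θ₂ k)
        * (Real.sin θ₁ * v 0 - Real.cos θ₁ * v 1) := by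
    rw [← hm]
    simp only [stepHat, Matrix.cons_val_zero, Matrix.cons_val_one, map_mul, ← Complex.exp_conj,
      Complex.conj_I, Complex.conj_ofReal, mul_neg]
    ring
  have h0 : ‖stepHat θ₁ k v 0‖ = ‖Real.cos θ₁ * v 0 + Real.sin θ₁ * v 1‖ := by
    simp only [stepHat, Matrix.cons_val_zero]
    rw [norm_mul, Complex.norm_exp_ofReal_mul_I, one_mul]
  have h1 : ‖stepHat θ₁ k v 1‖ = ‖Real.sin θ₁ * v 0 - Real.cos θ₁ * v 1‖ := by
    simp only [stepHat, Matrix.cons_val_one, Matrix.cons_val_fin_one]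
    rw [norm_mul, ← neg_mul, ← Complex.ofReal_neg, Complex.norm_exp_ofReal_mul_I, one_mul]
  rw [axisQuad, axisQuad, hx, h0, h1, velocity_comm θ₂ θ₁]
  simp only [← Complex.normSq_eq_norm_sq, Complex.normSq_apply, Complex.add_re, Complex.add_im,
    Complex.sub_re, Complex.sub_im, Complex.ofReal_re, Complex.ofReal_im,
    Complex.mul_re, Complex.mul_im, Complex.conj_re, Complex.conj_im]
  set n := velocity θ₁ θ₂ k
  set m := (axisOff θ₁ θ₂ k).re
  set m' := (axisOff θ₁ θ₂ k).im
  have hsc := Real.sin_sq_add_cos_sq θ₁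
  set Δ := (v 0).re ^ 2 + (v 0).im ^ 2 - ((v 1).re ^ 2 + (v 1).im ^ 2) with hΔ
  set x := (v 0).re * (v 1).re + (v 0).im * (v 1).im with hx'
  set y := (v 0).re * (v 1).im - (v 0).im * (v 1).re with hy'
  linear_combination (2 * Real.sin θ₁ * Δ - 4 * Real.cos θ₁ * x) * hc
    + (n * Δ + 2 * m * x - 2 * m' * y) * hsc

theorem abs_velocity_le_one {θ₁ θ₂ k : ℝ} (hs : sinQuasi θ₁ θ₂ k ≠ 0) :
    |velocity θ₁ θ₂ k| ≤ 1 := by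
  rw [← sq_le_one_iff_abs_le_one]
  linarith [velocity_sq_add_normSq_axisOff hs, Complex.normSq_nonneg (axisOff θ₁ θ₂ k)]

theorem stationary_eq {θ₁ θ₂ k : ℝ} (hs : sinQuasi θ₁ θ₂ k ≠ 0) (u : ℝ) (φ : ℝ → Fin 2 → ℂ)
    (j : Fin 2) : stationary θ₁ θ₂ u φ j k
      = Complex.exp ((-u : ℝ) * velocity θ₁ θ₂ k * Complex.I)
          * ((1 + innerSign j * velocity θ₁ θ₂ k) / 4
            * (‖φ k 0‖ ^ 2 + ‖φ k 1‖ ^ 2 + axisQuad θ₁ θ₂ k (φ k)) : ℝ)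
        + Complex.exp (u * velocity θ₁ θ₂ k * Complex.I)
          * ((1 - innerSign j * velocity θ₁ θ₂ k) / 4
            * (‖φ k 0‖ ^ 2 + ‖φ k 1‖ ^ 2 - axisQuad θ₁ θ₂ k (φ k)) : ℝ) := by
  have h1 := conj_branch_mul_branch hs (σ := 1) (by norm_num) (φ k) j
  have h2 := conj_branch_mul_branch hs (σ := -1) (by norm_num) (φ k) j
  rw [Complex.ofReal_one] at h1
  rw [Complex.ofReal_neg, Complex.ofReal_one] at h2
  rw [stationary, h1, h2]
  congr 3
  · ring
  · ring_nf

theorem stationary_periodic (θ₁ θ₂ u : ℝ) {φ : ℝ → Fin 2 → ℂ}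
    (hper : Function.Periodic φ (2 * Real.pi)) (j : Fin 2) :
    Function.Periodic (stationary θ₁ θ₂ u φ j) (2 * Real.pi) := by
  intro k
  have h1 : velocity θ₁ θ₂ (k + 2 * Real.pi) = velocity θ₁ θ₂ k := by
    rw [two_mul, ← add_assoc, velocity_add_pi, velocity_add_pi]
  have h2 : axisOff θ₁ θ₂ (k + 2 * Real.pi) = axisOff θ₁ θ₂ k := by
    rw [two_mul, ← add_assoc, axisOff_add_pi, axisOff_add_pi]
  simp only [stationary, branch, axisOp, h1, h2, hper k]

/-- The integral of the non-oscillating part depends on the initial state only through the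
symmetrised expectation of the axis. -/
theorem integral_stationary {θ₁ θ₂ : ℝ} (hc₁ : Real.cos θ₁ ≠ 0) (hc₂ : Real.cos θ₂ ≠ 0)
    (hs₁ : Real.sin θ₁ ≠ 0) (hs₂ : Real.sin θ₂ ≠ 0) {c : ℝ}
    (hc : c = min |Real.cos θ₁| |Real.cos θ₂|) {φ : ℝ → Fin 2 → ℂ} (hφ : Continuous φ)
    (hper : Function.Periodic φ (2 * Real.pi)) {C : ℝ}
    (hC0 : 0 ≤ C) (hC : ∀ k, ‖φ k 0‖ ^ 2 + ‖φ k 1‖ ^ 2 ≤ C ^ 2)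
    (hT : ∀ k, ‖φ k 0‖ ^ 2 + ‖φ k 1‖ ^ 2
      + (‖φ (k + Real.pi) 0‖ ^ 2 + ‖φ (k + Real.pi) 1‖ ^ 2) = 2) {K : ℝ}
    (hQ : ∀ k, axisQuad θ₁ θ₂ k (φ k) + axisQuad θ₁ θ₂ (k + Real.pi) (φ (k + Real.pi))
      - (axisQuad θ₁ θ₂ (-k) (φ (-k)) + axisQuad θ₁ θ₂ (-k + Real.pi) (φ (-k + Real.pi)))
        = 4 * K * velocity θ₁ θ₂ k) (u : ℝ) (j : Fin 2) :
    ∫ k in (-Real.pi)..Real.pi, stationary θ₁ θ₂ u φ j k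
      = ∫ y in Set.Ioo (-c) c, arcDensity c y • (Complex.exp (u * y * Complex.I)
        * ((1 - innerSign j * y) / 2 * (1 - K * y) : ℝ)) := by
  set S := stationary θ₁ θ₂ u φ j with hS
  have hae : ∀ᵐ k : ℝ, sinQuasi θ₁ θ₂ k ≠ 0 :=
    ae_sin_two_mul_ne_zero.mono fun k hk => (sinQuasi_pos hc₁ hc₂ hk).ne'
  have hi : ∀ a b : ℝ, IntervalIntegrable S volume a b :=
    intervalIntegrable_of_ae_bound (measurable_stationary θ₁ θ₂ u hφ j)
      (hae.mono fun k hk => norm_stationary_le hk (hC k) hC0 j)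
  have hSp := stationary_periodic θ₁ θ₂ u hper j
  rw [← hS] at hSp
  have hshift : ∫ k in (-Real.pi)..Real.pi, S (k + Real.pi) = ∫ k in (-Real.pi)..Real.pi, S k := by
    have h := hSp.intervalIntegral_add_eq (-Real.pi) 0
    rw [show -Real.pi + 2 * Real.pi = Real.pi by ring] at h
    rw [intervalIntegral.integral_comp_add_right, h]
    congr 1 <;> ring
  have hneg : ∀ f : ℝ → ℂ, ∫ k in (-Real.pi)..Real.pi, f (-k) = ∫ k in (-Real.pi)..Real.pi, f k := by
    intro f
    rw [intervalIntegral.integral_comp_neg, neg_neg]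
  have hi2 : ∀ a b : ℝ, IntervalIntegrable (fun k => S (k + Real.pi)) volume a b := by
    intro a b
    simpa using (hi (a + Real.pi) (b + Real.pi)).comp_add_right Real.pi
  have hin : ∀ f : ℝ → ℂ, (∀ a b, IntervalIntegrable f volume a b) →
      ∀ a b, IntervalIntegrable (fun k => f (-k)) volume a b := by
    intro f hf a b
    simpa using (IntervalIntegrable.iff_comp_neg (f := f) (a := -a) (b := -b)).1 (hf _ _)
  set F : ℝ → ℂ := fun y => Complex.exp (u * y * Complex.I)
    * ((1 - innerSign j * y) / 2 * (1 - K * y) : ℝ) with hF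
  have hFc : Continuous F := by fun_prop
  obtain ⟨M, hM⟩ := (isCompact_Icc (a := (-1 : ℝ)) (b := 1)).exists_bound_of_continuousOn
    hFc.continuousOn
  have hFi := intervalIntegrable_of_ae_bound (hFc.measurable.comp (measurable_velocity θ₁ θ₂))
    (hae.mono fun k hk => hM _ (abs_le.1 (abs_velocity_le_one hk)))
  simp only [Function.comp_def] at hFi
  -- The velocity is unchanged by `k ↦ k + π` and odd under `k ↦ -k`, so of the four weights only
  -- the sums controlled by `hT` and `hQ` remain. The branch `σ = 1` moves with velocity `-v`, which
  -- turns `1 + innerSign j * v` into `1 - innerSign j * y`.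
  have havg : ∫ k in (-Real.pi)..Real.pi, (S k + S (k + Real.pi) + (S (-k) + S (-k + Real.pi)))
      = ∫ k in (-Real.pi)..Real.pi,
        (2 * (F (velocity θ₁ θ₂ k)) + 2 * F (velocity θ₁ θ₂ (-k))) := by
    refine intervalIntegral.integral_congr_ae (hae.mono fun k hk _ => ?_)
    have hk2 := hk
    rw [← sinQuasi_neg] at hk2
    have hk1 := hk
    rw [← sinQuasi_add_pi] at hk1
    have hk3 := hk2
    rw [← sinQuasi_add_pi] at hk3
    simp only [hS, hF]
    rw [stationary_eq hk, stationary_eq hk1, stationary_eq hk2, stationary_eq hk3]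
    simp only [velocity_add_pi, velocity_neg]
    have t1 := hT k
    have t2 := hT (-k)
    have q := hQ k
    generalize ‖φ k 0‖ ^ 2 + ‖φ k 1‖ ^ 2 = T1 at t1 ⊢
    generalize ‖φ (k + Real.pi) 0‖ ^ 2 + ‖φ (k + Real.pi) 1‖ ^ 2 = T2 at t1 ⊢
    generalize ‖φ (-k) 0‖ ^ 2 + ‖φ (-k) 1‖ ^ 2 = T3 at t2 ⊢
    generalize ‖φ (-k + Real.pi) 0‖ ^ 2 + ‖φ (-k + Real.pi) 1‖ ^ 2 = T4 at t2 ⊢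
    generalize axisQuad θ₁ θ₂ k (φ k) = Q1 at q ⊢
    generalize axisQuad θ₁ θ₂ (k + Real.pi) (φ (k + Real.pi)) = Q2 at q ⊢
    generalize axisQuad θ₁ θ₂ (-k) (φ (-k)) = Q3 at q ⊢
    generalize axisQuad θ₁ θ₂ (-k + Real.pi) (φ (-k + Real.pi)) = Q4 at q ⊢
    generalize velocity θ₁ θ₂ k = n at q ⊢
    have t1' : (T1 + T2 : ℂ) = 2 := by exact_mod_cast t1
    have t2' : (T3 + T4 : ℂ) = 2 := by exact_mod_cast t2
    have q' : (Q1 + Q2 - (Q3 + Q4) : ℂ) = 4 * K * n := by exact_mod_cast q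
    push_cast
    simp only [mul_neg, neg_mul, neg_neg]
    generalize Complex.exp (u * n * Complex.I) = e
    generalize Complex.exp (-(u * n * Complex.I)) = e'
    generalize (innerSign j : ℂ) = τ
    linear_combination (e' * ((1 + τ * n) / 4) + e * ((1 - τ * n) / 4)) * (t1' + t2')
      + (e' * ((1 + τ * n) / 4) - e * ((1 - τ * n) / 4)) * q'
  have hFn : ∫ k in (-Real.pi)..Real.pi, F (velocity θ₁ θ₂ (-k))
      = ∫ k in (-Real.pi)..Real.pi, F (velocity θ₁ θ₂ k) := hneg fun k => F (velocity θ₁ θ₂ k)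
  rw [intervalIntegral.integral_add ((hi _ _).add (hi2 _ _))
    ((hin S hi _ _).add (hin _ hi2 _ _)), intervalIntegral.integral_add (hi _ _) (hi2 _ _),
    intervalIntegral.integral_add (hin S hi _ _) (hin _ hi2 _ _), hshift, hneg S,
    hneg fun k => S (k + Real.pi), hshift,
    intervalIntegral.integral_add ((hFi _ _).const_mul 2) ((hin _ hFi _ _).const_mul 2),
    intervalIntegral.integral_const_mul, intervalIntegral.integral_const_mul, hFn] at havg
  rw [← integral_comp_velocity hc₁ hc₂ hs₁ hs₂ hc hFc]
  linear_combination havg / 4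

/-! ### The Fourier transform of the walk, Parseval, and the initial data -/

/-- The Fourier transform of the initial state. -/
noncomputable def initHat (αm βm α₀ β₀ : ℂ) (k : ℝ) : Fin 2 → ℂ :=
  fun j => Complex.exp (k * Complex.I) * ![αm, βm] j + ![α₀, β₀] j

/-- The Fourier transform of the walk started from `initialState`. -/
noncomputable def walkHat (θ₁ θ₂ : ℝ) (αm βm α₀ β₀ : ℂ) (k : ℝ) : ℕ → Fin 2 → ℂ
  | 0 => initHat αm βm α₀ β₀ k
  | t + 1 => stepHat (if Even t then θ₁ else θ₂) k (walkHat θ₁ θ₂ αm βm α₀ β₀ k t)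

theorem hasSum_ket (k : ℝ) (x₀ : ℤ) (v : Fin 2 → ℂ) (j : Fin 2) :
    HasSum (fun x : ℤ => Complex.exp (-(k * x * Complex.I)) * ket x₀ v x j)
      (Complex.exp (-(k * x₀ * Complex.I)) * v j) := by
  have h := hasSum_single (f := fun x : ℤ => Complex.exp (-(k * x * Complex.I)) * ket x₀ v x j) x₀
    (fun x hx => by simp [ket, hx])
  simpa [ket] using h

theorem hasSum_walk (θ₁ θ₂ : ℝ) (αm βm α₀ β₀ : ℂ) (k : ℝ) (t : ℕ) (j : Fin 2) :
    HasSum (fun x : ℤ => Complex.exp (-(k * x * Complex.I))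
      * walk θ₁ θ₂ (initialState αm βm α₀ β₀) t x j) (walkHat θ₁ θ₂ αm βm α₀ β₀ k t j) := by
  induction t generalizing j with
  | zero =>
    have h := (hasSum_ket k (-1) ![αm, βm] j).add (hasSum_ket k 0 ![α₀, β₀] j)
    simp only [← mul_add] at h
    simpa [walk, initialState, walkHat, initHat] using h
  | succ t ih =>
    set θ := if Even t then θ₁ else θ₂ with hθ
    fin_cases j
    · have h := (Equiv.addRight (1 : ℤ)).hasSum_iff.2
        (((ih 0).mul_left (Real.cos θ : ℂ)).add ((ih 1).mul_left (Real.sin θ : ℂ)))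
      have h2 := h.mul_left (Complex.exp (k * Complex.I))
      refine Eq.mpr (congrArg (HasSum · _) (funext fun x : ℤ => ?_)) h2
      have e : Complex.exp (-(k * x * Complex.I))
          = Complex.exp (k * Complex.I) * Complex.exp (-(k * (x + 1 : ℤ) * Complex.I)) := by
        rw [← Complex.exp_add]; push_cast; ring_nf
      simp only [walk, shift, coinOp, ← hθ, Function.comp, Equiv.coe_addRight, e]
      simp [coin, Matrix.mulVec, dotProduct, Fin.sum_univ_two]
      ring
    · have h := (Equiv.subRight (1 : ℤ)).hasSum_iff.2
        (((ih 0).mul_left (Real.sin θ : ℂ)).sub ((ih 1).mul_left (Real.cos θ : ℂ)))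
      have h2 := h.mul_left (Complex.exp (-(k * Complex.I)))
      refine Eq.mpr (congrArg (HasSum · _) (funext fun x : ℤ => ?_)) h2
      have e : Complex.exp (-(k * x * Complex.I))
          = Complex.exp (-(k * Complex.I)) * Complex.exp (-(k * (x - 1 : ℤ) * Complex.I)) := by
        rw [← Complex.exp_add]; push_cast; ring_nf
      simp only [walk, shift, coinOp, ← hθ, Function.comp, Equiv.subRight_apply, e]
      simp [coin, Matrix.mulVec, dotProduct, Fin.sum_univ_two]
      ring

theorem walkHat_two_mul (θ₁ θ₂ : ℝ) (αm βm α₀ β₀ : ℂ) (k : ℝ) (n : ℕ) :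
    walkHat θ₁ θ₂ αm βm α₀ β₀ k (2 * n) = evolve θ₁ θ₂ n k (initHat αm βm α₀ β₀ k) := by
  induction n with
  | zero => rfl
  | succ n ih =>
    rw [evolve_succ, ← ih, mul_add, mul_one, walkHat, walkHat, if_pos (even_two_mul n),
      if_neg (by simp)]

/-- Seen from time `1` the coins alternate in the opposite order, so odd times are an even-time
problem with exchanged angles and initial vector `stepHat θ₁ k` applied to the original. -/
theorem walkHat_two_mul_add_one (θ₁ θ₂ : ℝ) (αm βm α₀ β₀ : ℂ) (k : ℝ) (n : ℕ) :
    walkHat θ₁ θ₂ αm βm α₀ β₀ k (2 * n + 1)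
      = evolve θ₂ θ₁ n k (stepHat θ₁ k (initHat αm βm α₀ β₀ k)) := by
  induction n with
  | zero => simp [walkHat, evolve]
  | succ n ih =>
    rw [evolve_succ, ← ih, mul_add, mul_one, walkHat,
      if_pos (show Even (2 * n + 2) by simp [Nat.even_add]), walkHat, if_neg (by simp)]

theorem integral_exp_int_mul (m : ℤ) :
    ∫ k in (-Real.pi)..Real.pi, Complex.exp (k * m * Complex.I)
      = if m = 0 then (2 * Real.pi : ℂ) else 0 := by
  split_ifs with h
  · simp [h]; ring
  · have hc : (m * Complex.I : ℂ) ≠ 0 := mul_ne_zero (by exact_mod_cast h) Complex.I_ne_zero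
    have h1 := integral_exp_mul_complex (a := -Real.pi) (b := Real.pi) hc
    have e : Complex.exp (m * Complex.I * Real.pi)
        = Complex.exp (m * Complex.I * (-Real.pi : ℝ)) := by
      refine Complex.exp_eq_exp_iff_exists_int.2 ⟨m, ?_⟩
      push_cast; ring
    rw [e, sub_self, zero_div] at h1
    rw [← h1]
    congr 1
    ext k
    ring_nf

/-- Parseval's identity for a finitely supported sequence and its modulation. -/
theorem integral_conj_sum_mul_sum (S : Finset ℤ) (a : ℤ → ℂ) (l : ℝ) :
    ∫ k in (-Real.pi)..Real.pi,
      starRingEnd ℂ (∑ x ∈ S, Complex.exp (-(k * x * Complex.I)) * a x)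
        * ∑ y ∈ S, Complex.exp (-((k - l : ℝ) * y * Complex.I)) * a y
      = 2 * Real.pi * ∑ x ∈ S, Complex.exp (l * x * Complex.I) * (‖a x‖ ^ 2 : ℝ) := by
  have h1 : ∀ k : ℝ, starRingEnd ℂ (∑ x ∈ S, Complex.exp (-(k * x * Complex.I)) * a x)
        * ∑ y ∈ S, Complex.exp (-((k - l : ℝ) * y * Complex.I)) * a y
      = ∑ x ∈ S, ∑ y ∈ S, (starRingEnd ℂ (a x) * a y * Complex.exp (l * y * Complex.I))
        * Complex.exp (k * (x - y : ℤ) * Complex.I) := by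
    intro k
    rw [map_sum, Finset.sum_mul_sum]
    refine Finset.sum_congr rfl fun x _ => Finset.sum_congr rfl fun y _ => ?_
    have e : Complex.exp (k * x * Complex.I) * Complex.exp (-((k - l : ℝ) * y * Complex.I))
        = Complex.exp (l * y * Complex.I) * Complex.exp (k * (x - y : ℤ) * Complex.I) := by
      rw [← Complex.exp_add, ← Complex.exp_add]; push_cast; ring_nf
    have e2 : starRingEnd ℂ (Complex.exp (-(k * x * Complex.I)))
        = Complex.exp (k * x * Complex.I) := by
      rw [← Complex.exp_conj]; simp
    rw [map_mul, e2]
    linear_combination (starRingEnd ℂ (a x) * a y) * e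
  simp_rw [h1]
  rw [intervalIntegral.integral_finsetSum fun x _ =>
    Continuous.intervalIntegrable (by fun_prop) _ _, Finset.mul_sum]
  refine Finset.sum_congr rfl fun x hx => ?_
  rw [intervalIntegral.integral_finsetSum fun y _ =>
    Continuous.intervalIntegrable (by fun_prop) _ _]
  simp_rw [intervalIntegral.integral_const_mul, integral_exp_int_mul, sub_eq_zero]
  rw [Finset.sum_eq_single_of_mem x hx fun y _ hy => by simp [hy.symm]]
  rw [if_pos rfl, Complex.ofReal_pow, ← Complex.conj_mul']
  ring

theorem tendsto_of_even_of_odd {α : Type*} {f : ℕ → α} {l : Filter α}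
    (h0 : Tendsto (fun n => f (2 * n)) atTop l) (h1 : Tendsto (fun n => f (2 * n + 1)) atTop l) :
    Tendsto f atTop l := by
  intro s hs
  obtain ⟨a, ha⟩ := mem_atTop_sets.1 (h0 hs)
  obtain ⟨b, hb⟩ := mem_atTop_sets.1 (h1 hs)
  refine mem_atTop_sets.2 ⟨2 * (a + b) + 1, fun t ht => ?_⟩
  rcases Nat.even_or_odd' t with ⟨n, rfl | rfl⟩
  · exact ha n (by omega)
  · exact hb n (by omega)

theorem continuous_initHat (αm βm α₀ β₀ : ℂ) : Continuous (initHat αm βm α₀ β₀) := by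
  unfold initHat; fun_prop

theorem exp_add_pi_mul_I (k : ℝ) :
    Complex.exp ((k + Real.pi : ℝ) * Complex.I) = -Complex.exp (k * Complex.I) := by
  rw [Complex.ofReal_add, add_mul, Complex.exp_add, Complex.exp_pi_mul_I, mul_neg_one]

theorem initHat_periodic (αm βm α₀ β₀ : ℂ) :
    Function.Periodic (initHat αm βm α₀ β₀) (2 * Real.pi) := by
  intro k
  funext j
  simp only [initHat, two_mul, ← add_assoc, exp_add_pi_mul_I, neg_neg]

theorem stepHat_periodic (θ : ℝ) {φ : ℝ → Fin 2 → ℂ} (hφ : Function.Periodic φ (2 * Real.pi)) :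
    Function.Periodic (fun k => stepHat θ k (φ k)) (2 * Real.pi) := by
  intro k
  have h : Complex.exp ((k + 2 * Real.pi : ℝ) * Complex.I) = Complex.exp (k * Complex.I) := by
    rw [two_mul, ← add_assoc, exp_add_pi_mul_I, exp_add_pi_mul_I, neg_neg]
  simp only [stepHat, hφ k, Complex.exp_neg, h]

/-- Shifting by `π` changes the sign of `e^{ik}`, and the parallelogram law cancels the interference
between the sites `-1` and `0`. -/
theorem norm_sq_initHat_add_pi {αm βm α₀ β₀ : ℂ}
    (hnorm : ‖αm‖ ^ 2 + ‖βm‖ ^ 2 + ‖α₀‖ ^ 2 + ‖β₀‖ ^ 2 = 1) (k : ℝ) :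
    ‖initHat αm βm α₀ β₀ k 0‖ ^ 2 + ‖initHat αm βm α₀ β₀ k 1‖ ^ 2
      + (‖initHat αm βm α₀ β₀ (k + Real.pi) 0‖ ^ 2 + ‖initHat αm βm α₀ β₀ (k + Real.pi) 1‖ ^ 2)
      = 2 := by
  have h : ∀ x y : ℂ, ‖Complex.exp (k * Complex.I) * x + y‖ ^ 2
      + ‖-Complex.exp (k * Complex.I) * x + y‖ ^ 2 = 2 * (‖x‖ ^ 2 + ‖y‖ ^ 2) := by
    intro x y
    have h := parallelogram_law_with_norm ℝ y (Complex.exp (k * Complex.I) * x)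
    rw [norm_mul, Complex.norm_exp_ofReal_mul_I] at h
    rw [neg_mul, add_comm, add_comm (-_), ← sub_eq_add_neg, add_comm (_ * x)]
    linarith
  simp only [initHat, exp_add_pi_mul_I, Matrix.cons_val_zero, Matrix.cons_val_one]
  linarith [h αm α₀, h βm β₀]

/-- The slope of the linear factor of the limit density. -/
noncomputable def slope (θ₁ : ℝ) (αm βm α₀ β₀ : ℂ) : ℝ :=
  ‖αm‖ ^ 2 + ‖α₀‖ ^ 2 - ‖βm‖ ^ 2 - ‖β₀‖ ^ 2
      + 2 * Real.sin θ₁ * (αm * starRingEnd ℂ βm + α₀ * starRingEnd ℂ β₀).re / Real.cos θ₁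

/-- The shift by `π` separates the two sites. Antisymmetrising in `k` removes the imaginary part of
`axisOff`, which is even; the velocity and the real part, equal to `tan θ₁` times the velocity, are
odd and survive. Each operation contributes a factor `2`. -/
theorem axisQuad_initHat {θ₁ : ℝ} (hc₁ : Real.cos θ₁ ≠ 0) (θ₂ : ℝ) (αm βm α₀ β₀ : ℂ) (k : ℝ) :
    axisQuad θ₁ θ₂ k (initHat αm βm α₀ β₀ k)
      + axisQuad θ₁ θ₂ (k + Real.pi) (initHat αm βm α₀ β₀ (k + Real.pi))
      - (axisQuad θ₁ θ₂ (-k) (initHat αm βm α₀ β₀ (-k))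
        + axisQuad θ₁ θ₂ (-k + Real.pi) (initHat αm βm α₀ β₀ (-k + Real.pi)))
        = 4 * slope θ₁ αm βm α₀ β₀ * velocity θ₁ θ₂ k := by
  have h1 : ∀ k : ℝ, axisQuad θ₁ θ₂ k (initHat αm βm α₀ β₀ k)
      + axisQuad θ₁ θ₂ (k + Real.pi) (initHat αm βm α₀ β₀ (k + Real.pi))
      = 2 * (axisQuad θ₁ θ₂ k ![αm, βm] + axisQuad θ₁ θ₂ k ![α₀, β₀]) := by
    intro k
    rw [axisQuad_add_pi]
    have he : Complex.normSq (Complex.exp (k * Complex.I)) = 1 := by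
      rw [Complex.normSq_eq_norm_sq, Complex.norm_exp_ofReal_mul_I, one_pow]
    simp only [axisQuad, initHat, exp_add_pi_mul_I, Matrix.cons_val_zero, Matrix.cons_val_one,
      ← Complex.normSq_eq_norm_sq]
    generalize Complex.exp (k * Complex.I) = e at he ⊢
    simp only [Complex.normSq_apply, Complex.add_re, Complex.add_im, Complex.neg_re,
      Complex.neg_im, Complex.mul_re, Complex.mul_im, Complex.conj_re, Complex.conj_im] at he ⊢
    linear_combination (2 * (velocity θ₁ θ₂ k * (αm.re ^ 2 + αm.im ^ 2 - βm.re ^ 2 - βm.im ^ 2)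
      + 2 * ((αm.re * (axisOff θ₁ θ₂ k).re + αm.im * (axisOff θ₁ θ₂ k).im) * βm.re
        - (αm.re * (axisOff θ₁ θ₂ k).im - αm.im * (axisOff θ₁ θ₂ k).re) * βm.im))) * he
  have hm : (axisOff θ₁ θ₂ k).re = Real.sin θ₁ / Real.cos θ₁ * velocity θ₁ θ₂ k := by
    have := cos_mul_axisOff_re θ₁ θ₂ k
    field_simp
    linarith
  rw [h1, h1]
  simp only [axisQuad, velocity_neg, axisOff_neg, slope, Matrix.cons_val_zero,
    Matrix.cons_val_one, ← Complex.normSq_eq_norm_sq]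
  simp only [Complex.normSq_apply, Complex.add_re, Complex.neg_re,
      Complex.neg_im, Complex.mul_re, Complex.mul_im, Complex.conj_re, Complex.conj_im, hm]
  ring

/-- The product of slope and cosine is the inner product of the unit vector `(cos θ₁, sin θ₁)` with
`(Δ, 2R)`, a vector of length at most one by Cauchy–Schwarz. It makes the linear factor nonnegative
where the limit density lives. -/
theorem abs_slope_mul_cos_le {θ₁ : ℝ} (hc₁ : Real.cos θ₁ ≠ 0) {αm βm α₀ β₀ : ℂ}
    (hnorm : ‖αm‖ ^ 2 + ‖βm‖ ^ 2 + ‖α₀‖ ^ 2 + ‖β₀‖ ^ 2 = 1) :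
    |slope θ₁ αm βm α₀ β₀| * |Real.cos θ₁| ≤ 1 := by
  rw [← abs_mul, ← sq_le_one_iff_abs_le_one]
  set R := (αm * starRingEnd ℂ βm + α₀ * starRingEnd ℂ β₀).re with hR
  have hR1 : |R| ≤ ‖αm‖ * ‖βm‖ + ‖α₀‖ * ‖β₀‖ := by
    refine (Complex.abs_re_le_norm _).trans ((norm_add_le _ _).trans ?_)
    simp only [norm_mul, RCLike.norm_conj, le_refl]
  have hR2 : R ^ 2 ≤ (‖αm‖ ^ 2 + ‖α₀‖ ^ 2) * (‖βm‖ ^ 2 + ‖β₀‖ ^ 2) := by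
    have h := sq_le_sq' (by linarith [abs_nonneg R]) hR1
    rw [sq_abs] at h
    nlinarith [sq_nonneg (‖αm‖ * ‖β₀‖ - ‖α₀‖ * ‖βm‖)]
  set Δ := ‖αm‖ ^ 2 + ‖α₀‖ ^ 2 - ‖βm‖ ^ 2 - ‖β₀‖ ^ 2 with hΔ
  have hK : slope θ₁ αm βm α₀ β₀ * Real.cos θ₁ = Real.cos θ₁ * Δ + 2 * Real.sin θ₁ * R := by
    rw [slope]; field_simp; ring
  rw [hK]
  have h2 : Δ ^ 2 + 4 * R ^ 2 ≤ 1 := by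
    have h3 : (‖αm‖ ^ 2 + ‖α₀‖ ^ 2) + (‖βm‖ ^ 2 + ‖β₀‖ ^ 2) = 1 := by linarith
    have h4 : Δ = (‖αm‖ ^ 2 + ‖α₀‖ ^ 2) - (‖βm‖ ^ 2 + ‖β₀‖ ^ 2) := by rw [hΔ]; ring
    rw [h4]
    nlinarith
  have h5 : (Real.cos θ₁ * Δ + 2 * Real.sin θ₁ * R) ^ 2
      + (Real.sin θ₁ * Δ - 2 * Real.cos θ₁ * R) ^ 2 = Δ ^ 2 + 4 * R ^ 2 := by
    linear_combination (Δ ^ 2 + 4 * R ^ 2) * Real.sin_sq_add_cos_sq θ₁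
  linarith [sq_nonneg (Real.sin θ₁ * Δ - 2 * Real.cos θ₁ * R)]

/-! ### Probabilities as momentum integrals -/

/-- The sites carrying a nonzero amplitude at time `t`. -/
noncomputable def supportSites (θ₁ θ₂ : ℝ) (αm βm α₀ β₀ : ℂ) (t : ℕ) : Finset ℤ :=
  (finite_support_walk θ₁ θ₂ αm βm α₀ β₀ t).toFinset

theorem walk_eq_zero {θ₁ θ₂ : ℝ} {αm βm α₀ β₀ : ℂ} {t : ℕ} {x : ℤ}
    (hx : x ∉ supportSites θ₁ θ₂ αm βm α₀ β₀ t) :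
    walk θ₁ θ₂ (initialState αm βm α₀ β₀) t x = 0 := by
  simpa [supportSites] using hx

theorem walkHat_eq_sum (θ₁ θ₂ : ℝ) (αm βm α₀ β₀ : ℂ) (k : ℝ) (t : ℕ) (j : Fin 2) :
    walkHat θ₁ θ₂ αm βm α₀ β₀ k t j = ∑ x ∈ supportSites θ₁ θ₂ αm βm α₀ β₀ t,
      Complex.exp (-(k * x * Complex.I)) * walk θ₁ θ₂ (initialState αm βm α₀ β₀) t x j :=
  (hasSum_walk θ₁ θ₂ αm βm α₀ β₀ k t j).unique
    (hasSum_sum_of_ne_finset_zero fun x hx => by simp [walk_eq_zero hx])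

theorem sum_exp_mul_prob (θ₁ θ₂ : ℝ) (αm βm α₀ β₀ : ℂ) (l : ℝ) (t : ℕ) (j : Fin 2) :
    ∑ x ∈ supportSites θ₁ θ₂ αm βm α₀ β₀ t, Complex.exp (l * x * Complex.I)
        * prob (walk θ₁ θ₂ (initialState αm βm α₀ β₀) t) x j
      = (2 * Real.pi : ℂ)⁻¹ * ∫ k in (-Real.pi)..Real.pi,
        starRingEnd ℂ (walkHat θ₁ θ₂ αm βm α₀ β₀ k t j)
          * walkHat θ₁ θ₂ αm βm α₀ β₀ (k - l) t j := by
  have h := integral_conj_sum_mul_sum (supportSites θ₁ θ₂ αm βm α₀ β₀ t)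
    (fun x => walk θ₁ θ₂ (initialState αm βm α₀ β₀) t x j) l
  simp only [← walkHat_eq_sum] at h
  have hpi : (Real.pi : ℂ) ≠ 0 := by exact_mod_cast Real.pi_ne_zero
  rw [h, ← mul_assoc, inv_mul_cancel₀ (mul_ne_zero two_ne_zero hpi), one_mul]
  rfl

theorem continuous_walkHat (θ₁ θ₂ : ℝ) (αm βm α₀ β₀ : ℂ) (t : ℕ) :
    Continuous fun k => walkHat θ₁ θ₂ αm βm α₀ β₀ k t := by
  induction t with
  | zero => exact continuous_initHat αm βm α₀ β₀
  | succ t ih => exact continuous_stepHat _ ih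

theorem norm_sq_walkHat (θ₁ θ₂ : ℝ) (αm βm α₀ β₀ : ℂ) (k : ℝ) (t : ℕ) :
    ‖walkHat θ₁ θ₂ αm βm α₀ β₀ k t 0‖ ^ 2 + ‖walkHat θ₁ θ₂ αm βm α₀ β₀ k t 1‖ ^ 2
      = ‖initHat αm βm α₀ β₀ k 0‖ ^ 2 + ‖initHat αm βm α₀ β₀ k 1‖ ^ 2 := by
  induction t with
  | zero => rfl
  | succ t ih => rw [walkHat, norm_sq_stepHat, ih]

theorem integral_norm_sq_initHat {αm βm α₀ β₀ : ℂ}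
    (hnorm : ‖αm‖ ^ 2 + ‖βm‖ ^ 2 + ‖α₀‖ ^ 2 + ‖β₀‖ ^ 2 = 1) :
    ∫ k in (-Real.pi)..Real.pi,
      (‖initHat αm βm α₀ β₀ k 0‖ ^ 2 + ‖initHat αm βm α₀ β₀ k 1‖ ^ 2) = 2 * Real.pi := by
  set f : ℝ → ℝ := fun k => ‖initHat αm βm α₀ β₀ k 0‖ ^ 2 + ‖initHat αm βm α₀ β₀ k 1‖ ^ 2 with hf
  have hfp : Function.Periodic f (2 * Real.pi) := fun k => by
    simp only [hf, initHat_periodic αm βm α₀ β₀ k]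
  have hfc : Continuous f := by
    have := continuous_initHat αm βm α₀ β₀
    have h : ∀ j, Continuous fun k => initHat αm βm α₀ β₀ k j := fun j => by fun_prop
    exact ((h 0).norm.pow 2).add ((h 1).norm.pow 2)
  have hshift : ∫ k in (-Real.pi)..Real.pi, f (k + Real.pi) = ∫ k in (-Real.pi)..Real.pi, f k := by
    have h := hfp.intervalIntegral_add_eq (-Real.pi) 0
    rw [show -Real.pi + 2 * Real.pi = Real.pi by ring] at h
    rw [intervalIntegral.integral_comp_add_right, h]
    congr 1 <;> ring
  have h2 : ∫ k in (-Real.pi)..Real.pi, (f k + f (k + Real.pi))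
      = ∫ _ in (-Real.pi)..Real.pi, (2 : ℝ) :=
    intervalIntegral.integral_congr fun k _ => norm_sq_initHat_add_pi hnorm k
  have hfc2 : Continuous fun k => f (k + Real.pi) := hfc.comp (continuous_add_const _)
  rw [intervalIntegral.integral_add (hfc.intervalIntegrable _ _)
    (hfc2.intervalIntegrable _ _), hshift,
    intervalIntegral.integral_const, smul_eq_mul] at h2
  linarith

theorem sum_prob_le_one (θ₁ θ₂ : ℝ) {αm βm α₀ β₀ : ℂ}
    (hnorm : ‖αm‖ ^ 2 + ‖βm‖ ^ 2 + ‖α₀‖ ^ 2 + ‖β₀‖ ^ 2 = 1) (t : ℕ) (j : Fin 2) :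
    ∑ x ∈ supportSites θ₁ θ₂ αm βm α₀ β₀ t,
      prob (walk θ₁ θ₂ (initialState αm βm α₀ β₀) t) x j ≤ 1 := by
  have h : ∀ j, ∑ x ∈ supportSites θ₁ θ₂ αm βm α₀ β₀ t,
      prob (walk θ₁ θ₂ (initialState αm βm α₀ β₀) t) x j
      = (2 * Real.pi)⁻¹ * ∫ k in (-Real.pi)..Real.pi, ‖walkHat θ₁ θ₂ αm βm α₀ β₀ k t j‖ ^ 2 := by
    intro j
    have h1 := sum_exp_mul_prob θ₁ θ₂ αm βm α₀ β₀ 0 t j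
    simp only [Complex.ofReal_zero, zero_mul, Complex.exp_zero, one_mul, sub_zero,
      Complex.conj_mul'] at h1
    simp only [← Complex.ofReal_pow, intervalIntegral.integral_ofReal] at h1
    exact_mod_cast h1
  have hnn : ∀ j, 0 ≤ ∑ x ∈ supportSites θ₁ θ₂ αm βm α₀ β₀ t,
      prob (walk θ₁ θ₂ (initialState αm βm α₀ β₀) t) x j := fun j =>
    Finset.sum_nonneg fun x _ => sq_nonneg _
  have hc : ∀ j, Continuous fun k => ‖walkHat θ₁ θ₂ αm βm α₀ β₀ k t j‖ ^ 2 := fun j => by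
    have := continuous_walkHat θ₁ θ₂ αm βm α₀ β₀ t
    have h : Continuous fun k => walkHat θ₁ θ₂ αm βm α₀ β₀ k t j := by fun_prop
    exact h.norm.pow 2
  have htot : ∑ x ∈ supportSites θ₁ θ₂ αm βm α₀ β₀ t,
        prob (walk θ₁ θ₂ (initialState αm βm α₀ β₀) t) x 0
      + ∑ x ∈ supportSites θ₁ θ₂ αm βm α₀ β₀ t,
        prob (walk θ₁ θ₂ (initialState αm βm α₀ β₀) t) x 1 = 1 := by
    rw [h, h, ← mul_add, ← intervalIntegral.integral_add ((hc 0).intervalIntegrable _ _)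
      ((hc 1).intervalIntegrable _ _)]
    simp_rw [norm_sq_walkHat]
    rw [integral_norm_sq_initHat hnorm]
    exact inv_mul_cancel₀ (by positivity)
  have h0 := hnn 0
  have h1 := hnn 1
  fin_cases j <;> simp only [Fin.zero_eta, Fin.mk_one] <;> linarith

/-! ### The limit density and convergence of the characteristic functions -/

/-- The limit density for the inner state `j` in terms of `c = |cos θ_ξ|` and the slope `K`. -/
noncomputable def limitDensity (c : ℝ) (j : Fin 2) (K : ℝ) : ℝ → ℝ :=
  Set.indicator (Set.Ioo (-c) c) fun y =>
    arcDensity c y * ((1 - innerSign j * y) / 2 * (1 - K * y) / (2 * Real.pi))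

theorem integrable_limitDensity {c : ℝ} (hc0 : 0 < c) (hc1 : c < 1) (j : Fin 2) (K : ℝ) :
    Integrable (limitDensity c j K) := by
  refine IntegrableOn.integrable_indicator ?_ measurableSet_Ioo
  exact (integrableOn_arcDensity hc0 hc1).mul_continuousOn_of_subset (K := Set.Icc (-c) c)
    (by fun_prop) measurableSet_Ioo isCompact_Icc Set.Ioo_subset_Icc_self

/-- Needed so that the limit is a measure, to which the continuity theorem applies. -/
theorem limitDensity_nonneg {c : ℝ} (hc1 : c < 1) (j : Fin 2) {K : ℝ} (hK : |K| * c ≤ 1)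
    (y : ℝ) : 0 ≤ limitDensity c j K y := by
  refine Set.indicator_nonneg (fun y hy => ?_) y
  have h1 : |y| ≤ c := abs_le.2 ⟨hy.1.le, hy.2.le⟩
  have h2 := (abs_mul K y).le.trans ((mul_le_mul_of_nonneg_left h1 (abs_nonneg K)).trans hK)
  have h3 : 0 ≤ 1 - K * y := by linarith [le_abs_self (K * y)]
  have h4 : 0 ≤ 1 - innerSign j * y := by
    have := abs_le.1 h1
    fin_cases j <;> simp [innerSign] <;> linarith
  have h5 : 0 ≤ 1 - y ^ 2 := by
    have := abs_le.1 h1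
    nlinarith
  have h6 : 0 ≤ arcDensity c y := by unfold arcDensity; positivity
  have := Real.pi_pos
  positivity

theorem tendsto_sum_exp_mul_prob {θ₁ θ₂ : ℝ} (hc₁ : Real.cos θ₁ ≠ 0) (hc₂ : Real.cos θ₂ ≠ 0)
    (hs₁ : Real.sin θ₁ ≠ 0) (hs₂ : Real.sin θ₂ ≠ 0) {c : ℝ}
    (hc : c = min |Real.cos θ₁| |Real.cos θ₂|) {αm βm α₀ β₀ : ℂ}
    (hnorm : ‖αm‖ ^ 2 + ‖βm‖ ^ 2 + ‖α₀‖ ^ 2 + ‖β₀‖ ^ 2 = 1) (j : Fin 2) (u : ℝ) :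
    Tendsto (fun t : ℕ => ∑ y ∈ supportSites θ₁ θ₂ αm βm α₀ β₀ t,
      Complex.exp (u * ((y : ℝ) / (t : ℝ) : ℝ) * Complex.I)
        * prob (walk θ₁ θ₂ (initialState αm βm α₀ β₀) t) y j) atTop
      (𝓝 (∫ y : ℝ, Complex.exp (u * y * Complex.I)
        * limitDensity c j (slope θ₁ αm βm α₀ β₀) y)) := by
  set K := slope θ₁ αm βm α₀ β₀ with hK
  have e1 : ∀ t : ℕ, ∑ y ∈ supportSites θ₁ θ₂ αm βm α₀ β₀ t,
      Complex.exp (u * ((y : ℝ) / (t : ℝ) : ℝ) * Complex.I)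
        * prob (walk θ₁ θ₂ (initialState αm βm α₀ β₀) t) y j
      = (2 * Real.pi : ℂ)⁻¹ * ∫ k in (-Real.pi)..Real.pi,
        starRingEnd ℂ (walkHat θ₁ θ₂ αm βm α₀ β₀ k t j)
          * walkHat θ₁ θ₂ αm βm α₀ β₀ (k - u / t) t j := by
    intro t
    rw [← sum_exp_mul_prob]
    refine Finset.sum_congr rfl fun y _ => ?_
    push_cast
    ring_nf
  have e2 : ∫ y : ℝ, Complex.exp (u * y * Complex.I) * limitDensity c j K y
      = (2 * Real.pi : ℂ)⁻¹ * ∫ y in Set.Ioo (-c) c, arcDensity c y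
        • (Complex.exp (u * y * Complex.I)
          * ((1 - innerSign j * y) / 2 * (1 - K * y) : ℝ)) := by
    rw [← integral_const_mul, ← integral_indicator measurableSet_Ioo]
    congr 1
    ext y
    by_cases hy : y ∈ Set.Ioo (-c) c
    · simp only [limitDensity, Set.indicator_of_mem hy, Complex.real_smul]
      push_cast
      ring
    · simp only [limitDensity, Set.indicator_of_notMem hy, Complex.ofReal_zero, mul_zero]
  simp_rw [e1]
  rw [e2]
  refine Tendsto.const_mul _ ?_
  set φ := initHat αm βm α₀ β₀ with hφ
  have hφc := continuous_initHat αm βm α₀ β₀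
  have hT := norm_sq_initHat_add_pi hnorm
  -- By `hT` the squared norm is at most `2`, so `C = 2` is a convenient bound.
  have hC : ∀ k, ‖φ k 0‖ ^ 2 + ‖φ k 1‖ ^ 2 ≤ (2 : ℝ) ^ 2 := by
    intro k
    have := hT k
    nlinarith [sq_nonneg ‖φ (k + Real.pi) 0‖, sq_nonneg ‖φ (k + Real.pi) 1‖]
  set ψ : ℝ → Fin 2 → ℂ := fun k => stepHat θ₁ k (φ k) with hψ
  have hψc : Continuous ψ := continuous_stepHat θ₁ hφc
  have hψn : ∀ k, ‖ψ k 0‖ ^ 2 + ‖ψ k 1‖ ^ 2 = ‖φ k 0‖ ^ 2 + ‖φ k 1‖ ^ 2 := fun k =>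
    norm_sq_stepHat θ₁ k (φ k)
  have hnat : Tendsto (fun n : ℕ => (2 * n : ℝ)) atTop atTop :=
    tendsto_natCast_atTop_atTop.const_mul_atTop two_pos
  refine tendsto_of_even_of_odd ?_ ?_
  · have h := tendsto_integral_evolve hc₁ hc₂ hφc zero_le_two hC hnat
      (by
        refine (tendsto_const_nhds (x := (1 / 2 : ℝ))).congr' ?_
        filter_upwards [eventually_ge_atTop 1] with n hn
        have : (n : ℝ) ≠ 0 := by positivity
        field_simp) u j
    rw [integral_stationary hc₁ hc₂ hs₁ hs₂ hc hφc (initHat_periodic _ _ _ _) zero_le_two hC hT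
      (axisQuad_initHat hc₁ θ₂ αm βm α₀ β₀)] at h
    refine h.congr fun n => ?_
    simp only [walkHat_two_mul, Nat.cast_mul, Nat.cast_ofNat]
  -- Odd times: exchanged angles, `T n = 2n + 1`, and the stepped initial vector. The slope `K` is
  -- still that of the first coin, since the step preserves `axisQuad` and the velocity is symmetric
  -- in the angles.
  · have h := tendsto_integral_evolve hc₂ hc₁ hψc zero_le_two (fun k => (hψn k).le.trans (hC k))
      (T := fun n : ℕ => (2 * n + 1 : ℝ)) (tendsto_atTop_add_const_right _ 1 hnat)
      (by
        have h1 : Tendsto (fun n : ℕ => 1 / 2 - 1 / 2 * (2 * (n : ℝ) + 1)⁻¹) atTop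
            (𝓝 (1 / 2 - 1 / 2 * 0)) :=
          ((tendsto_inv_atTop_zero.comp (tendsto_atTop_add_const_right _ 1 hnat)).const_mul
            (1 / 2)).const_sub (1 / 2)
        rw [mul_zero, sub_zero] at h1
        refine h1.congr fun n => ?_
        have : (2 * (n : ℝ) + 1) ≠ 0 := by positivity
        field_simp
        ring) u j
    rw [integral_stationary hc₂ hc₁ hs₂ hs₁ (hc.trans (min_comm _ _)) hψc
      (stepHat_periodic θ₁ (initHat_periodic _ _ _ _)) zero_le_two
      (fun k => (hψn k).le.trans (hC k)) (fun k => by rw [hψn, hψn]; exact hT k) (K := K)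
      (fun k => by
        simp only [hψ, axisQuad_stepHat]
        rw [velocity_comm]
        exact axisQuad_initHat hc₁ θ₂ αm βm α₀ β₀ k)] at h
    refine h.congr fun n => ?_
    simp only [walkHat_two_mul_add_one, Nat.cast_mul, Nat.cast_ofNat, Nat.cast_add, Nat.cast_one]
    rfl

/-! ### Passage to the stated distribution functions and densities -/

theorem cdfInner_eq_sum (θ₁ θ₂ : ℝ) (αm βm α₀ β₀ : ℂ) (t : ℕ) (x : ℝ) (j : Fin 2) :
    cdfInner (walk θ₁ θ₂ (initialState αm βm α₀ β₀) t) t x j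
      = ∑ y ∈ (supportSites θ₁ θ₂ αm βm α₀ β₀ t).filter (fun y : ℤ => (y : ℝ) / (t : ℝ) ≤ x),
        prob (walk θ₁ θ₂ (initialState αm βm α₀ β₀) t) y j := by
  refine (tsum_subtype {y : ℤ | (y : ℝ) / (t : ℝ) ≤ x}
    (fun y => prob (walk θ₁ θ₂ (initialState αm βm α₀ β₀) t) y j)).trans ?_
  rw [tsum_eq_sum (s := supportSites θ₁ θ₂ αm βm α₀ β₀ t), Finset.sum_filter]
  · rfl
  · intro y hy
    simp [Set.indicator, prob, walk_eq_zero hy]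

theorem cdf_eq_add (θ₁ θ₂ : ℝ) (αm βm α₀ β₀ : ℂ) (t : ℕ) (x : ℝ) :
    cdf (walk θ₁ θ₂ (initialState αm βm α₀ β₀) t) t x
      = cdfInner (walk θ₁ θ₂ (initialState αm βm α₀ β₀) t) t x 0
        + cdfInner (walk θ₁ θ₂ (initialState αm βm α₀ β₀) t) t x 1 := by
  rw [cdfInner_eq_sum, cdfInner_eq_sum, ← Finset.sum_add_distrib]
  refine (tsum_subtype {y : ℤ | (y : ℝ) / (t : ℝ) ≤ x}
    (fun y => ∑ j, prob (walk θ₁ θ₂ (initialState αm βm α₀ β₀) t) y j)).trans ?_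
  rw [tsum_eq_sum (s := supportSites θ₁ θ₂ αm βm α₀ β₀ t), Finset.sum_filter]
  · simp only [Fin.sum_univ_two]
    rfl
  · intro y hy
    simp [Set.indicator, prob, walk_eq_zero hy]

/-- The factor `1 - y` from the branch weight cancels against `1 - y²`, leaving `1 + y` in the
denominator. -/
theorem density0_eq {θ c : ℝ} (hc : |Real.cos θ| = c) (hc1 : c < 1) (K : ℝ) :
    density0 θ (fun y => 1 - K * y) = limitDensity c 0 K := by
  have hs : √(1 - c ^ 2) = |Real.sin θ| := by
    rw [← hc, sq_abs, ← Real.sin_sq, Real.sqrt_sq_eq_abs]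
  rw [density0, limitDensity, hc]
  refine Set.indicator_congr fun y hy => ?_
  have h1 : 1 - y ≠ 0 := by linarith [hy.2]
  have h2 : 1 + y ≠ 0 := by linarith [hy.1]
  have h3 : 0 < √(c ^ 2 - y ^ 2) := Real.sqrt_pos.2 (by nlinarith [hy.1, hy.2])
  have h4 : Real.cos θ ^ 2 = c ^ 2 := by rw [← hc, sq_abs]
  simp only [arcDensity, hs, h4, innerSign, Matrix.cons_val_zero]
  rw [show 1 - y ^ 2 = (1 - y) * (1 + y) by ring]
  have := Real.pi_pos
  field_simp

theorem density1_eq {θ c : ℝ} (hc : |Real.cos θ| = c) (hc1 : c < 1) (K : ℝ) :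
    density1 θ (fun y => 1 - K * y) = limitDensity c 1 K := by
  have hs : √(1 - c ^ 2) = |Real.sin θ| := by
    rw [← hc, sq_abs, ← Real.sin_sq, Real.sqrt_sq_eq_abs]
  rw [density1, limitDensity, hc]
  refine Set.indicator_congr fun y hy => ?_
  have h1 : 1 - y ≠ 0 := by linarith [hy.2]
  have h2 : 1 + y ≠ 0 := by linarith [hy.1]
  have h3 : 0 < √(c ^ 2 - y ^ 2) := Real.sqrt_pos.2 (by nlinarith [hy.1, hy.2])
  have h4 : Real.cos θ ^ 2 = c ^ 2 := by rw [← hc, sq_abs]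
  simp only [arcDensity, hs, h4, innerSign, Matrix.cons_val_one, Matrix.cons_val_fin_one]
  rw [show 1 - y ^ 2 = (1 - y) * (1 + y) by ring]
  have := Real.pi_pos
  field_simp
  ring

theorem density_eq_add {θ : ℝ} (hs : Real.sin θ ≠ 0) (η : ℝ → ℝ) :
    density θ η = fun y => density0 θ η y + density1 θ η y := by
  have hc1 : |Real.cos θ| < 1 := by
    rw [← sq_lt_one_iff_abs_lt_one]
    have : 0 < Real.sin θ ^ 2 := by positivity
    linarith [Real.sin_sq_add_cos_sq θ]
  funext y
  simp only [density, density0, density1]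
  by_cases hy : y ∈ Set.Ioo (-|Real.cos θ|) |Real.cos θ|
  · simp only [Set.indicator_of_mem hy]
    have h1 : 1 - y ≠ 0 := by linarith [hy.2]
    have h2 : 1 + y ≠ 0 := by linarith [hy.1]
    have h3 : 0 < √(Real.cos θ ^ 2 - y ^ 2) :=
      Real.sqrt_pos.2 (by rw [← sq_abs (Real.cos θ)]; nlinarith [hy.1, hy.2])
    have := Real.pi_pos
    rw [show 1 - y ^ 2 = (1 - y) * (1 + y) by ring]
    field_simp
    ring
  · simp only [Set.indicator_of_notMem hy, add_zero]

theorem cos_ne_zero_and_sin_ne_zero {θ : ℝ} (h : θ ∈ Set.Ico 0 (2 * Real.pi))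
    (h' : θ ∉ ({0, Real.pi / 2, Real.pi, 3 * Real.pi / 2} : Set ℝ)) :
    Real.cos θ ≠ 0 ∧ Real.sin θ ≠ 0 := by
  have hpi := Real.pi_pos
  simp only [Set.mem_insert_iff, Set.mem_singleton_iff, not_or] at h'
  obtain ⟨h0, h1, h2, h3⟩ := h'
  constructor
  · intro hc
    obtain ⟨n, hn⟩ := Real.cos_eq_zero_iff.1 hc
    have ha : (-1 : ℝ) < n := by nlinarith [h.1]
    have hb : (n : ℝ) < 2 := by nlinarith [h.2]
    have ha' : -1 < n := by exact_mod_cast ha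
    have hb' : n < 2 := by exact_mod_cast hb
    interval_cases n
    · exact h1 (by rw [hn]; push_cast; ring)
    · exact h3 (by rw [hn]; push_cast; ring)
  · intro hs
    obtain ⟨n, hn⟩ := Real.sin_eq_zero_iff.1 hs
    have ha : (-1 : ℝ) < n := by nlinarith [h.1]
    have hb : (n : ℝ) < 2 := by nlinarith [h.2]
    have ha' : -1 < n := by exact_mod_cast ha
    have hb' : n < 2 := by exact_mod_cast hb
    interval_cases n
    · exact h0 (by rw [← hn]; simp)
    · exact h2 (by rw [← hn]; simp)

end TwoPeriodWalk

theorem mainTheorem2 (θ₁ θ₂ : ℝ)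
    (hθ₁ : θ₁ ∈ Set.Ico 0 (2 * Real.pi)) (hθ₂ : θ₂ ∈ Set.Ico 0 (2 * Real.pi))
    (hθ₁' : θ₁ ∉ ({0, Real.pi / 2, Real.pi, 3 * Real.pi / 2} : Set ℝ))
    (hθ₂' : θ₂ ∉ ({0, Real.pi / 2, Real.pi, 3 * Real.pi / 2} : Set ℝ))
    (αm βm α₀ β₀ : ℂ) (hnorm : ‖αm‖ ^ 2 + ‖βm‖ ^ 2 + ‖α₀‖ ^ 2 + ‖β₀‖ ^ 2 = 1)
    (ξ : Fin 2)
    (hξ : |Real.cos (![θ₁, θ₂] ξ)| = min |Real.cos θ₁| |Real.cos θ₂|)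
    (Φ : ℕ → TwoPeriodWalk.State)
    (hΦ : Φ = TwoPeriodWalk.walk θ₁ θ₂ (TwoPeriodWalk.initialState αm βm α₀ β₀))
    (η : ℝ → ℝ) (hη : η = TwoPeriodWalk.eta θ₁ αm βm α₀ β₀) :
    (Integrable (TwoPeriodWalk.density0 (![θ₁, θ₂] ξ) η) ∧
      Integrable (TwoPeriodWalk.density1 (![θ₁, θ₂] ξ) η) ∧
      Integrable (TwoPeriodWalk.density (![θ₁, θ₂] ξ) η)) ∧
    ∀ x : ℝ,
      Tendsto (fun t : ℕ => TwoPeriodWalk.cdfInner (Φ t) t x 0) atTop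
          (𝓝 (∫ y in Set.Iic x, TwoPeriodWalk.density0 (![θ₁, θ₂] ξ) η y)) ∧
      Tendsto (fun t : ℕ => TwoPeriodWalk.cdfInner (Φ t) t x 1) atTop
          (𝓝 (∫ y in Set.Iic x, TwoPeriodWalk.density1 (![θ₁, θ₂] ξ) η y)) ∧
      Tendsto (fun t : ℕ => TwoPeriodWalk.cdf (Φ t) t x) atTop
          (𝓝 (∫ y in Set.Iic x, TwoPeriodWalk.density (![θ₁, θ₂] ξ) η y)) := by
  subst hΦ hη
  obtain ⟨hc₁, hs₁⟩ := TwoPeriodWalk.cos_ne_zero_and_sin_ne_zero hθ₁ hθ₁'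
  obtain ⟨hc₂, hs₂⟩ := TwoPeriodWalk.cos_ne_zero_and_sin_ne_zero hθ₂ hθ₂'
  have hsξ : Real.sin (![θ₁, θ₂] ξ) ≠ 0 := by
    fin_cases ξ
    · exact hs₁
    · exact hs₂
  -- Only `|cos θ_ξ|` and `sin θ_ξ ≠ 0` matter from here on, so a tie between the two coins is
  -- harmless.
  generalize ![θ₁, θ₂] ξ = θ at hξ hsξ ⊢
  set c := min |Real.cos θ₁| |Real.cos θ₂| with hc
  set K := TwoPeriodWalk.slope θ₁ αm βm α₀ β₀ with hK
  have hc0 : 0 < c := lt_min (abs_pos.2 hc₁) (abs_pos.2 hc₂)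
  have hc1 : c < 1 := by
    rw [← hξ, ← sq_lt_one_iff_abs_lt_one]
    have : 0 < Real.sin θ ^ 2 := by positivity
    linarith [Real.sin_sq_add_cos_sq θ]
  -- The slope is bounded against the first coin, and `c ≤ |cos θ₁|` whichever coin attains the
  -- minimum.
  have hKc : |K| * c ≤ 1 :=
    (mul_le_mul_of_nonneg_left (min_le_left _ _) (abs_nonneg K)).trans
      (TwoPeriodWalk.abs_slope_mul_cos_le hc₁ hnorm)
  have hη : TwoPeriodWalk.eta θ₁ αm βm α₀ β₀ = fun y => 1 - K * y := rfl
  have hi := TwoPeriodWalk.integrable_limitDensity hc0 hc1 (K := K)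
  rw [TwoPeriodWalk.density_eq_add hsξ, hη, TwoPeriodWalk.density0_eq hξ hc1,
    TwoPeriodWalk.density1_eq hξ hc1]
  have hlim : ∀ (x : ℝ) (j : Fin 2), Tendsto (fun t : ℕ => TwoPeriodWalk.cdfInner
      (TwoPeriodWalk.walk θ₁ θ₂ (TwoPeriodWalk.initialState αm βm α₀ β₀) t) t x j) atTop
      (𝓝 (∫ y in Set.Iic x, TwoPeriodWalk.limitDensity c j K y)) := by
    intro x j
    simp_rw [TwoPeriodWalk.cdfInner_eq_sum]
    exact TwoPeriodWalk.tendsto_sum_filter_of_tendsto_exp (fun t y => sq_nonneg _)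
      (fun t => TwoPeriodWalk.sum_prob_le_one θ₁ θ₂ hnorm t j)
      (TwoPeriodWalk.limitDensity_nonneg hc1 j hKc) (hi j)
      (TwoPeriodWalk.tendsto_sum_exp_mul_prob hc₁ hc₂ hs₁ hs₂ hc hnorm j) x
  refine ⟨⟨hi 0, hi 1, (hi 0).add (hi 1)⟩, fun x => ⟨hlim x 0, hlim x 1, ?_⟩⟩
  simp_rw [TwoPeriodWalk.cdf_eq_add]
  rw [integral_add (hi 0).integrableOn (hi 1).integrableOn]
  exact (hlim x 0).add (hlim x 1)
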